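/- For every dimension $d\ge 1$ let $f=f_d$ be the standard Gaussian distribution on $\mathbb R^d$ and let $A=A_d\subset\mathbb R^d$ be a measurable set; write $p_f(A)=\mathbb P_f(X\in A)$ and let $f|_A$ be $f$ conditioned on $A$. A sequence $g=g_d$ of (possibly random) probability distributions on $\mathbb R^d$ is called \emph{efficient in high dimension for $A$} if, with $\ell=f/g$ the likelihood ratio, for every sequence of integers $n_p=n_p(d)\to\infty$, as $d\to\infty$, $$\mathbb E\left(\frac{\max_{i\le n_p}\ell(Y_i)}{\sum_{i\le n_p}\ell(Y_i)}\,\Big|\,g\right)\Rightarrow 0\quad\text{and}\quad \mathbb E\left(\left|\frac{1}{p_f(A)\,n_p}\sum_{i=1}^{n_p}\ell(Y_i)\mathbf 1_A(Y_i)-1\right|\,\Big|\,g\right)\Rightarrow 0,$$ where, given $g$, the $Y_i$ are i.i.d. with law $g$, and $\Rightarrow$ denotes convergence in distribution. Assume $\inf_d p_f(A)>0$, and let $\mu_A=\mathbb E_{f|_A}(X)$ and $\Sigma_A=\mathbb E_{f|_A}(XX^\top)-\mu_A\mu_A^\top$ be the mean and covariance matrix of $f|_A$. Then $g_A=N(\mu_A,\Sigma_A)$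 is efficient in high dimension for $A$. If moreover $n_g=n_g(d)$ is a sequence of integers with $n_g/d^2\to\infty$ and, for each $d$, $Y_{A,1},\dots,Y_{A,n_g}$ are i.i.d. with law $f|_A$, then $\hat g_A=N(\hat\mu_A,\hat\Sigma_A)$ with $$\hat\mu_A=\frac1{n_g}\sum_{k=1}^{n_g}Y_{A,k},\qquad \hat\Sigma_A=\frac1{n_g}\sum_{k=1}^{n_g}Y_{A,k}Y_{A,k}^\top-\hat\mu_A\hat\mu_A^\top$$ is also efficient in high dimension for $A$. -/

import Mathlib

open MeasureTheory ProbabilityTheory Filter Topology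

noncomputable section

namespace HighDimIS

/-- The Euclidean space `ℝ^d`. -/
abbrev Euc (d : ℕ+) : Type := EuclideanSpace ℝ (Fin (d : ℕ))

/-- The standard Gaussian distribution on `ℝ^d`. -/
abbrev stdN (d : ℕ+) : Measure (Euc d) := stdGaussian (Euc d)

/-- The likelihood ratio `ℓ = f / g` of two distributions: the density of `f` with respect to `g`,
which is the quotient of their Lebesgue densities when these are positive. -/
def likelihoodRatio {d : ℕ+} (f g : Measure (Euc d)) (x : Euc d) : ℝ :=
  (f.rnDeriv g x).toReal

/-- The expected weight-degeneracy ratio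
`E (max_{i ≤ n} ℓ(Y_i) / ∑_{i ≤ n} ℓ(Y_i))` with `Y_1, …, Y_n` i.i.d. of law `g`. -/
def weightRatio {d : ℕ+} (f g : Measure (Euc d)) (n : ℕ) : ℝ :=
  ∫ y : Fin n → Euc d,
    (⨆ i, likelihoodRatio f g (y i)) / ∑ i, likelihoodRatio f g (y i)
      ∂(Measure.pi fun _ : Fin n => g)

/-- The importance sampling estimator `(1/n) ∑_{i ≤ n} ℓ(y_i) 1_A(y_i)` of `p_f(A)`. -/
def isEstimator {d : ℕ+} (f g : Measure (Euc d)) (A : Set (Euc d)) (n : ℕ)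
    (y : Fin n → Euc d) : ℝ :=
  (1 / (n : ℝ)) * ∑ i, likelihoodRatio f g (y i) * A.indicator (fun _ => (1 : ℝ)) (y i)

/-- The relative `L¹` error `E |p̂_f(A) / p_f(A) - 1|` of the importance sampling estimator, with
`Y_1, …, Y_n` i.i.d. of law `g`. -/
def isError {d : ℕ+} (f g : Measure (Euc d)) (A : Set (Euc d)) (n : ℕ) : ℝ :=
  ∫ y : Fin n → Euc d, |isEstimator f g A n y / f.real A - 1| ∂(Measure.pi fun _ : Fin n => g)

/-- Convergence in distribution to the constant `0` of real random variables indexed by the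
dimension and defined on possibly different probability spaces. -/
def TendstoZeroInLaw {Ω : ℕ+ → Type*} [∀ d, MeasurableSpace (Ω d)]
    (P : ∀ d, Measure (Ω d)) [∀ d, IsProbabilityMeasure (P d)] (X : ∀ d, Ω d → ℝ) : Prop :=
  TendstoInDistribution X atTop (fun _ : Unit => (0 : ℝ)) P (Measure.dirac ())

/-- High-dimensional efficiency for `A` of a sequence of random auxiliary distributions
`g d ω`. The conditional expectations given `g` are the integrals with `g d ω` frozen. -/
def EfficientInHighDim {Ω : ℕ+ → Type*} [∀ d, MeasurableSpace (Ω d)]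
    (P : ∀ d, Measure (Ω d)) [∀ d, IsProbabilityMeasure (P d)]
    (f : ∀ d, Measure (Euc d)) (A : ∀ d, Set (Euc d)) (g : ∀ d, Ω d → Measure (Euc d)) : Prop :=
  ∀ n : ℕ+ → ℕ, Tendsto n atTop atTop →
    TendstoZeroInLaw P (fun d ω => weightRatio (f d) (g d ω) (n d)) ∧
    TendstoZeroInLaw P (fun d ω => isError (f d) (g d ω) (A d) (n d))

/-- High-dimensional efficiency for `A` of a sequence of deterministic auxiliary distributions:
the case of a one-point probability space. -/
def DetEfficientInHighDim (f : ∀ d, Measure (Euc d)) (A : ∀ d, Set (Euc d))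
    (g : ∀ d, Measure (Euc d)) : Prop :=
  EfficientInHighDim (Ω := fun _ => Unit) (fun _ => Measure.dirac ()) f A (fun d _ => g d)

/-- The mean `μ_A` of the conditioned distribution `f|_A`, with `f` standard Gaussian. -/
def condMean {d : ℕ+} (A : Set (Euc d)) : Euc d :=
  ∫ x, x ∂(cond (stdN d) A)

/-- The covariance matrix `Σ_A = E (X Xᵀ) - μ_A μ_Aᵀ` of `f|_A`, with `f` standard Gaussian. -/
def condCov {d : ℕ+} (A : Set (Euc d)) : Matrix (Fin (d : ℕ)) (Fin (d : ℕ)) ℝ :=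
  Matrix.of fun i j => (∫ x, x i * x j ∂(cond (stdN d) A)) - condMean A i * condMean A j

/-- The Gaussian distribution `g_A = N(μ_A, Σ_A)`. -/
def gaussA {d : ℕ+} (A : Set (Euc d)) : Measure (Euc d) :=
  multivariateGaussian (condMean A) (condCov A)

/-- The empirical mean `μ̂ = (1/n) ∑_k y_k`. -/
def empMean {d : ℕ+} {n : ℕ} (y : Fin n → Euc d) : Euc d :=
  (1 / (n : ℝ)) • ∑ k, y k

/-- The empirical covariance matrix `Σ̂ = (1/n) ∑_k y_k y_kᵀ - μ̂ μ̂ᵀ`. -/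
def empCov {d : ℕ+} {n : ℕ} (y : Fin n → Euc d) : Matrix (Fin (d : ℕ)) (Fin (d : ℕ)) ℝ :=
  Matrix.of fun i j => (1 / (n : ℝ)) * (∑ k, y k i * y k j) - empMean y i * empMean y j

/-- The Gaussian distribution `ĝ = N(μ̂, Σ̂)` estimated from the sample `y`. -/
def empGauss {d : ℕ+} {n : ℕ} (y : Fin n → Euc d) : Measure (Euc d) :=
  multivariateGaussian (empMean y) (empCov y)

end HighDimIS

end

/-! Everything reduces to bounding the relative entropy `D(f‖g) = E_f log (f/g)`, here `∫ logLR ∂f`,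
independently of `d`.

Bounded entropy gives efficiency. The `g`-mass of `ℓ` on `{ℓ > e^t}` is `P_f(ℓ > e^t)`, at most
`(D(f‖g) + 1)/t` by Markov. Truncating `ℓ` at `e^t` leaves averages with variance at most `e^t/n`,
so taking `t` large and then `n` large controls both the `L¹` error and the weight ratio
(`exists_forall_weightRatio_isError_le`).

For `g = N(μ, S)` the entropy is explicit, and it is bounded once the eigenvalues of `S` stay away
from `0` while `‖S - 1‖_F` and `|μ|` stay bounded (`integral_logLR_stdGaussian_le`).

For `g_A` these bounds come from the reversed entropy. Since `D(f|_A‖f) = -log p_f(A)`, the Gibbs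
variational inequality tested on `log (g_A/f)` gives `tr Σ_A - d - log det Σ_A + |μ_A|² ≤ -2 log
p_f(A)` (`trace_condCov_le`). The spectral part is a sum of nonnegative terms `λ - 1 - log λ`, which
controls both the smallest eigenvalue and the Frobenius distance to the identity.

For `ĝ_A`, there are of order `d²` empirical moments, each with mean squared error `O(1/n_g)`. As
`n_g/d² → ∞`, the parameters are Frobenius-close to `(μ_A, Σ_A)` with probability tending to one,
and the entropy bound is stable under such perturbations. -/

noncomputable section

set_option linter.unusedSectionVars false

namespace HighDimIS

/-! ### Gaussian densities and likelihood ratios under affine maps. -/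

section Density

variable {E : Type*} [NormedAddCommGroup E] [InnerProductSpace ℝ E] [FiniteDimensional ℝ E]
  [MeasurableSpace E] [BorelSpace E]

variable (E) in
/-- The normalising constant of the standard Gaussian density. -/
def gaussConst : ℝ := ((2 * Real.pi) ^ (Module.finrank ℝ E / 2 : ℝ))⁻¹

variable (E) in
lemma gaussConst_pos : 0 < gaussConst E := by
  unfold gaussConst; positivity

variable (E) in
-- Finite measures are determined by their characteristic functions, and that of the density is an
-- explicit Gaussian integral.
lemma stdGaussian_eq_withDensity :
    stdGaussian E = (volume : Measure E).withDensity
      (fun x => ENNReal.ofReal (gaussConst E * Real.exp (-‖x‖ ^ 2 / 2))) := by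
  have hint : Integrable (fun x : E => gaussConst E * Real.exp (-‖x‖ ^ 2 / 2)) := by
    have h := GaussianFourier.integrable_cexp_neg_mul_sq_norm_add (V := E) (b := (1 / 2 : ℂ))
      (by norm_num) 0 0
    refine (h.norm.congr (ae_of_all _ fun x => ?_)).const_mul _
    simp only [Complex.norm_exp]
    congr 1
    simp [← Complex.ofReal_pow]
    ring
  have : IsFiniteMeasure ((volume : Measure E).withDensity
      (fun x => ENNReal.ofReal (gaussConst E * Real.exp (-‖x‖ ^ 2 / 2)))) :=
    isFiniteMeasure_withDensity_ofReal hint.2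
  apply Measure.ext_of_charFun
  ext t
  rw [charFun_stdGaussian, charFun_apply, integral_withDensity_eq_integral_toReal_smul
    (by fun_prop) (by simp)]
  have h := GaussianFourier.integral_cexp_neg_mul_sq_norm_add (V := E) (b := (1 / 2 : ℂ))
      (by norm_num) Complex.I t
  have hpos := gaussConst_pos E
  have e : ∀ x : E, (ENNReal.ofReal (gaussConst E * Real.exp (-‖x‖ ^ 2 / 2))).toReal •
      Complex.exp (inner ℝ x t * Complex.I) = (gaussConst E : ℂ) *
      Complex.exp (-(1 / 2) * ‖x‖ ^ 2 + Complex.I * inner ℝ t x) := by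
    intro x
    rw [ENNReal.toReal_ofReal (by positivity), Complex.real_smul, Complex.exp_add,
      real_inner_comm t x]
    push_cast
    rw [mul_assoc]
    congr 2
    · congr 1; ring
    · ring_nf
  simp_rw [e]
  rw [integral_const_mul, h]
  have hc : (gaussConst E : ℂ) * ((Real.pi : ℂ) / (1 / 2)) ^ (Module.finrank ℝ E / 2 : ℂ) = 1 := by
    have h2 : ((Real.pi : ℂ) / (1 / 2)) = ((2 * Real.pi : ℝ) : ℂ) := by push_cast; ring
    have h3 : (Module.finrank ℝ E / 2 : ℂ) = ((Module.finrank ℝ E / 2 : ℝ) : ℂ) := by push_cast; rfl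
    rw [h2, h3, ← Complex.ofReal_cpow (by positivity), ← Complex.ofReal_mul, gaussConst,
      inv_mul_cancel₀ (by positivity), Complex.ofReal_one]
  rw [← mul_assoc, hc, one_mul]
  congr 1
  rw [Complex.I_sq]
  ring

/-- The logarithm of the ratio of the standard Gaussian density to the density of `μ + L Z`,
where `Z` is standard Gaussian and `M` is the inverse of `L`. -/
def logLR (μ : E) (M : E →L[ℝ] E) (x : E) : ℝ :=
  -Real.log |M.det| + ‖M (x - μ)‖ ^ 2 / 2 - ‖x‖ ^ 2 / 2

lemma continuous_logLR (μ : E) (M : E →L[ℝ] E) : Continuous (logLR μ M) := by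
  unfold logLR; fun_prop

@[fun_prop]
lemma measurable_logLR (μ : E) (M : E →L[ℝ] E) : Measurable (logLR μ M) :=
  (continuous_logLR μ M).measurable

lemma det_mul_det_of_comp_eq {L M : E →L[ℝ] E} (h : ∀ x, L (M x) = x) : L.det * M.det = 1 := by
  have : (L : E →ₗ[ℝ] E) ∘ₗ (M : E →ₗ[ℝ] E) = LinearMap.id := by ext x; simp [h]
  have h2 := LinearMap.det_comp (L : E →ₗ[ℝ] E) (M : E →ₗ[ℝ] E)
  rw [this, LinearMap.det_id] at h2
  exact h2.symm

lemma exp_neg_logLR {M : E →L[ℝ] E} (hM : M.det ≠ 0) (μ x : E) :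
    Real.exp (-logLR μ M x) = |M.det| * Real.exp (‖x‖ ^ 2 / 2 - ‖M (x - μ)‖ ^ 2 / 2) := by
  unfold logLR
  rw [show -(-Real.log |M.det| + ‖M (x - μ)‖ ^ 2 / 2 - ‖x‖ ^ 2 / 2) =
    Real.log |M.det| + (‖x‖ ^ 2 / 2 - ‖M (x - μ)‖ ^ 2 / 2) by ring, Real.exp_add,
    Real.exp_log (abs_pos.2 hM)]

lemma stdGaussian_map_affine (μ : E) {L M : E →L[ℝ] E} (h1 : ∀ x, L (M x) = x)
    (h2 : ∀ x, M (L x) = x) :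
    (stdGaussian E).map (fun z => μ + L z) =
      (stdGaussian E).withDensity (fun x => ENNReal.ofReal (Real.exp (-logLR μ M x))) := by
  have hdet : M.det ≠ 0 := right_ne_zero_of_mul_eq_one (det_mul_det_of_comp_eq h1)
  ext B hB
  have hmeas : Measurable (fun z => μ + L z) := by fun_prop
  rw [Measure.map_apply hmeas hB, withDensity_apply _ hB]
  have himg : (fun z => μ + L z) ⁻¹' B = (fun x => M (x - μ)) '' B := by
    ext z
    constructor
    · intro hz
      exact ⟨μ + L z, hz, by simp [h2]⟩
    · rintro ⟨x, hx, rfl⟩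
      simpa [h1] using hx
  have hc := gaussConst_pos E
  rw [stdGaussian_eq_withDensity E, restrict_withDensity hB,
    lintegral_withDensity_eq_lintegral_mul _ (by fun_prop) (by fun_prop),
    withDensity_apply _ (hB.preimage hmeas), himg,
    lintegral_image_eq_lintegral_abs_det_fderiv_mul volume hB (f' := fun _ => M)]
  · refine lintegral_congr fun x => ?_
    simp only [Pi.mul_apply]
    rw [← ENNReal.ofReal_mul (by positivity), ← ENNReal.ofReal_mul (by positivity),
      exp_neg_logLR hdet]
    congr 1
    rw [show ∀ a b c d : ℝ, a * b * (c * d) = c * (a * (b * d)) by intros; ring,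
      ← Real.exp_add]
    ring_nf
  · intro x _
    exact (M.hasFDerivAt.comp x ((hasFDerivAt_id x).sub_const μ)).hasFDerivWithinAt
  · intro x _ y _ hxy
    have := congrArg L hxy
    simpa [h1] using this

lemma rnDeriv_stdGaussian_map_affine (μ : E) {L M : E →L[ℝ] E} (h1 : ∀ x, L (M x) = x)
    (h2 : ∀ x, M (L x) = x) :
    (stdGaussian E).rnDeriv ((stdGaussian E).map (fun z => μ + L z))
      =ᵐ[(stdGaussian E).map (fun z => μ + L z)]
      fun x => ENNReal.ofReal (Real.exp (logLR μ M x)) := by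
  have hf : (stdGaussian E) = ((stdGaussian E).map (fun z => μ + L z)).withDensity
      (fun x => ENNReal.ofReal (Real.exp (logLR μ M x))) := by
    rw [stdGaussian_map_affine μ h1 h2, ← withDensity_mul _ (by fun_prop) (by fun_prop)]
    conv_lhs => rw [← withDensity_one (μ := stdGaussian E)]
    congr 1
    ext x
    simp only [Pi.mul_apply, Pi.one_apply]
    rw [← ENNReal.ofReal_mul (by positivity), ← Real.exp_add]
    simp
  have : IsProbabilityMeasure ((stdGaussian E).map (fun z => μ + L z)) :=
    Measure.isProbabilityMeasure_map (by fun_prop)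
  conv_lhs => enter [1]; rw [hf]
  exact Measure.rnDeriv_withDensity _ (by fun_prop)

lemma integral_exp_neg_logLR (μ : E) {L M : E →L[ℝ] E} (h1 : ∀ x, L (M x) = x)
    (h2 : ∀ x, M (L x) = x) :
    Integrable (fun x => Real.exp (-logLR μ M x)) (stdGaussian E) ∧
      ∫ x, Real.exp (-logLR μ M x) ∂(stdGaussian E) = 1 := by
  have hone : ∫⁻ x, ENNReal.ofReal (Real.exp (-logLR μ M x)) ∂(stdGaussian E) = 1 := by
    have h := stdGaussian_map_affine μ h1 h2
    have : IsProbabilityMeasure ((stdGaussian E).map (fun z => μ + L z)) :=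
      Measure.isProbabilityMeasure_map (by fun_prop)
    rw [← setLIntegral_univ, ← withDensity_apply _ MeasurableSet.univ, ← h, measure_univ]
  constructor
  · refine ⟨by fun_prop, ?_⟩
    rw [hasFiniteIntegral_iff_ofReal (ae_of_all _ fun x => (Real.exp_pos _).le), hone]
    simp
  · rw [integral_eq_lintegral_of_nonneg_ae (ae_of_all _ fun x => (Real.exp_pos _).le)
      (by fun_prop), hone]
    simp

/-- The marginal along `v` is a real Gaussian of variance `‖v‖² > 0`, hence without atoms. -/
lemma stdGaussian_hyperplane_eq_zero {v : E} (hv : v ≠ 0) (c : ℝ) :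
    stdGaussian E {x | inner ℝ v x = c} = 0 := by
  have h := IsGaussian.map_eq_gaussianReal (μ := stdGaussian E) (innerSL ℝ v)
  have hvar : Var[innerSL ℝ v; stdGaussian E] = ‖v‖ ^ 2 := by
    rw [variance_dual_stdGaussian, innerSL_apply_norm]
  rw [hvar] at h
  have hne : (‖v‖ ^ 2).toNNReal ≠ 0 := by
    have : 0 < ‖v‖ := norm_pos_iff.2 hv
    simpa using hv
  have := nullSingletonClass_gaussianReal (μ := (stdGaussian E)[innerSL ℝ v]) hne
  have h0 := measure_singleton (μ := gaussianReal ((stdGaussian E)[innerSL ℝ v])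
    (‖v‖ ^ 2).toNNReal) c
  rw [← h, Measure.map_apply (by fun_prop) (measurableSet_singleton c)] at h0
  exact h0

/-- The image law lives on a hyperplane that is null for the standard Gaussian, so the two measures
are mutually singular. This covers singular empirical covariances. -/
lemma rnDeriv_stdGaussian_map_affine_of_det_eq_zero (μ : E) {L : E →L[ℝ] E} (hL : L.det = 0) :
    (stdGaussian E).rnDeriv ((stdGaussian E).map (fun z => μ + L z))
      =ᵐ[(stdGaussian E).map (fun z => μ + L z)] 0 := by
  have : IsProbabilityMeasure ((stdGaussian E).map (fun z => μ + L z)) :=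
    Measure.isProbabilityMeasure_map (by fun_prop)
  rw [Measure.rnDeriv_eq_zero]
  have hker : ∃ v : E, v ≠ 0 ∧ ∀ z, inner ℝ v (L z) = 0 := by
    have hr : LinearMap.range (L : E →ₗ[ℝ] E) < ⊤ := LinearMap.range_lt_top_of_det_eq_zero hL
    have hb : (LinearMap.range (L : E →ₗ[ℝ] E))ᗮ ≠ ⊥ := by
      intro h
      exact hr.ne ((Submodule.orthogonal_eq_bot_iff).1 h)
    obtain ⟨v, hv, hv0⟩ := Submodule.exists_mem_ne_zero_of_ne_bot hb
    refine ⟨v, hv0, fun z => ?_⟩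
    rw [Submodule.mem_orthogonal'] at hv
    exact hv _ ⟨z, rfl⟩
  obtain ⟨v, hv, hz⟩ := hker
  have hm : MeasurableSet {x : E | inner ℝ v x = inner ℝ v μ} :=
    measurableSet_eq_fun (by fun_prop) (by fun_prop)
  refine ⟨{x : E | inner ℝ v x = inner ℝ v μ}, hm, stdGaussian_hyperplane_eq_zero hv _, ?_⟩
  rw [Measure.map_apply (by fun_prop) hm.compl]
  convert measure_empty (μ := stdGaussian E)
  ext z
  simp [inner_add_right, hz]

/-- The likelihood ratio along the parametrisation `z ↦ μ + L z`, in all cases. -/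
lemma rnDeriv_stdGaussian_comp_affine (μ : E) (L : E →L[ℝ] E) :
    ∀ᵐ z ∂(stdGaussian E), ((stdGaussian E).rnDeriv ((stdGaussian E).map (fun z => μ + L z))
      (μ + L z)).toReal = |L.det| * Real.exp (‖z‖ ^ 2 / 2 - ‖μ + L z‖ ^ 2 / 2) := by
  have hm : AEMeasurable (fun z => μ + L z) (stdGaussian E) := by fun_prop
  by_cases hL : L.det = 0
  · filter_upwards [ae_of_ae_map hm (rnDeriv_stdGaussian_map_affine_of_det_eq_zero μ hL)] with z hz
    simp [hz, hL]
  · let e := (LinearMap.equivOfDetNeZero (L : E →ₗ[ℝ] E) hL)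
    have he : ∀ x, e x = L x := fun x => rfl
    let M : E →L[ℝ] E := LinearMap.toContinuousLinearMap (e.symm : E →ₗ[ℝ] E)
    have hM : ∀ x, M x = e.symm x := fun x => rfl
    have h1 : ∀ x, L (M x) = x := fun x => by rw [← he, hM, e.apply_symm_apply]
    have h2 : ∀ x, M (L x) = x := fun x => by rw [← he, hM, e.symm_apply_apply]
    filter_upwards [ae_of_ae_map hm (rnDeriv_stdGaussian_map_affine μ h1 h2)] with z hz
    rw [hz, ENNReal.toReal_ofReal (Real.exp_pos _).le, logLR]
    have hd := det_mul_det_of_comp_eq h1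
    have hMi : |M.det| = |L.det|⁻¹ := by
      rw [eq_inv_of_mul_eq_one_right hd, abs_inv]
    simp only [add_sub_cancel_left, h2]
    rw [hMi, Real.log_inv, neg_neg, add_sub_assoc, Real.exp_add, Real.exp_log (abs_pos.2 hL)]

end Density

/-! ### Importance sampling errors for a general likelihood ratio. -/

section ImportanceSampling

variable {α : Type*} [MeasurableSpace α] {g : Measure α} [IsProbabilityMeasure g]

lemma integrable_comp_eval_pi {n : ℕ} {u : α → ℝ} (hu : Integrable u g) (i : Fin n) :
    Integrable (fun y : Fin n → α => u (y i)) (Measure.pi fun _ => g) :=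
  integrable_comp_eval (μ := fun _ : Fin n => g) hu

lemma integrable_average_pi {n : ℕ} {u : α → ℝ} (hu : Integrable u g) :
    Integrable (fun y : Fin n → α => (1 / (n : ℝ)) * ∑ i, u (y i)) (Measure.pi fun _ => g) :=
  (integrable_finsetSum _ fun i _ => integrable_comp_eval_pi hu i).const_mul _

lemma integral_average_pi {n : ℕ} (hn : n ≠ 0) {u : α → ℝ} (hu : Integrable u g) :
    ∫ y : Fin n → α, (1 / (n : ℝ)) * ∑ i, u (y i) ∂(Measure.pi fun _ => g) = ∫ x, u x ∂g := by
  rw [integral_const_mul, integral_finsetSum _ fun i _ => integrable_comp_eval_pi hu i]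
  have : ∀ i : Fin n, ∫ y : Fin n → α, u (y i) ∂(Measure.pi fun _ => g) = ∫ x, u x ∂g :=
    fun i => integral_comp_eval (μ := fun _ : Fin n => g) hu.1
  simp only [this, Finset.sum_const, Finset.card_univ, Fintype.card_fin, nsmul_eq_mul]
  field_simp

lemma memLp_average_sub_pi {n : ℕ} {v : α → ℝ} (hv : MemLp v 2 g) (q : ℝ) :
    MemLp (fun y : Fin n → α => (1 / (n : ℝ)) * ∑ i, v (y i) - q) 2 (Measure.pi fun _ => g) := by
  have hmem : ∀ i, MemLp (fun y : Fin n → α => v (y i)) 2 (Measure.pi fun _ => g) := fun i =>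
    hv.comp_measurePreserving (measurePreserving_eval (fun _ : Fin n => g) i)
  exact ((memLp_finsetSum _ fun i _ => hmem i).const_mul _).sub (memLp_const q)

/-- The variance of the empirical average of an i.i.d. sample. -/
lemma integral_sq_average_sub_le {n : ℕ} (hn : n ≠ 0) {v : α → ℝ} (hv : MemLp v 2 g) :
    ∫ y : Fin n → α, ((1 / (n : ℝ)) * ∑ i, v (y i) - ∫ x, v x ∂g) ^ 2 ∂(Measure.pi fun _ => g)
      ≤ (∫ x, v x ^ 2 ∂g) / n := by
  set P := Measure.pi fun _ : Fin n => g
  have hS : MemLp (fun y : Fin n → α => (1 / (n : ℝ)) * ∑ i, v (y i)) 2 P := by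
    simpa using memLp_average_sub_pi (n := n) hv 0
  have hE : ∫ y, (1 / (n : ℝ)) * ∑ i, v (y i) ∂P = ∫ x, v x ∂g :=
    integral_average_pi hn (hv.integrable one_le_two)
  have hvar : Var[fun y : Fin n → α => (1 / (n : ℝ)) * ∑ i, v (y i); P] = Var[v; g] / n := by
    rw [variance_const_mul]
    have := variance_sum_pi (μ := fun _ : Fin n => g) (X := fun _ => v) fun _ => hv
    have h2 : (fun y : Fin n → α => ∑ i, v (y i)) = ∑ i, fun y : Fin n → α => v (y i) := by
      ext y; simp
    rw [h2, this]
    simp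
    field_simp
  have h4 : Var[v; g] ≤ ∫ x, v x ^ 2 ∂g := by
    rw [variance_eq_sub hv]
    simp only [Pi.pow_apply]
    nlinarith [sq_nonneg (∫ x, v x ∂g)]
  rw [variance_eq_integral hS.1.aemeasurable, hE] at hvar
  rw [hvar]
  gcongr

lemma integral_abs_average_sub_le {n : ℕ} (hn : n ≠ 0) {v : α → ℝ} (hv : MemLp v 2 g) :
    ∫ y : Fin n → α, |(1 / (n : ℝ)) * ∑ i, v (y i) - ∫ x, v x ∂g| ∂(Measure.pi fun _ => g)
      ≤ √((∫ x, v x ^ 2 ∂g) / n) := by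
  have hX : MemLp (fun y : Fin n → α => |(1 / (n : ℝ)) * ∑ i, v (y i) - ∫ x, v x ∂g|) 2
    (Measure.pi fun _ => g) := (memLp_average_sub_pi hv _).abs
  have habs := variance_nonneg
    (fun y : Fin n → α => |(1 / (n : ℝ)) * ∑ i, v (y i) - ∫ x, v x ∂g|) (Measure.pi fun _ => g)
  rw [variance_eq_sub hX] at habs
  simp only [Pi.pow_apply, sq_abs] at habs
  exact Real.le_sqrt_of_sq_le ((sub_nonneg.1 habs).trans (integral_sq_average_sub_le hn hv))

variable {l : α → ℝ}

/-- Discard the values of `l` above `a`. What remains satisfies `v² ≤ a l`, so its second moment is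
at most `a` and its average errs by `√(a / n)`. The discarded mass counts twice: in the average and
in the expectation. The set `B` is later `A` for the estimator and everything for the total weight.
-/
lemma integral_abs_average_sub_le_of_tail (hlm : Measurable l) (hl0 : ∀ x, 0 ≤ l x)
    (hl : Integrable l g) (hl1 : ∫ x, l x ∂g = 1) {B : Set α} (hB : MeasurableSet B) {n : ℕ}
    (hn : n ≠ 0) {a : ℝ} (ha : 0 ≤ a) :
    ∫ y : Fin n → α, |(1 / (n : ℝ)) * ∑ i, B.indicator l (y i) - ∫ x, B.indicator l x ∂g|
      ∂(Measure.pi fun _ => g) ≤ 2 * ∫ x, {x | a < l x}.indicator l x ∂g + √(a / n) := by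
  set P := Measure.pi fun _ : Fin n => g
  have hT : MeasurableSet {x | a < l x} := measurableSet_lt measurable_const hlm
  set u := B.indicator l with hu
  set w := {x | a < l x}.indicator l with hw
  set v := (B ∩ {x | a < l x}ᶜ).indicator l with hv
  have hBT : MeasurableSet (B ∩ {x | a < l x}ᶜ) := hB.inter hT.compl
  have hui : Integrable u g := hl.indicator hB
  have hwi : Integrable w g := hl.indicator hT
  have hvi : Integrable v g := hl.indicator hBT
  have hv0 : ∀ x, 0 ≤ v x := fun x => Set.indicator_nonneg (fun x _ => hl0 x) x
  have hva : ∀ x, v x ≤ a := by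
    intro x
    by_cases hx : x ∈ B ∩ {x | a < l x}ᶜ
    · rw [hv, Set.indicator_of_mem hx]; simpa using hx.2
    · rw [hv, Set.indicator_of_notMem hx]; exact ha
  have hvl : ∀ x, v x ≤ l x := fun x => Set.indicator_le_self' (fun x _ => hl0 x) x
  have huv : ∀ x, 0 ≤ u x - v x ∧ u x - v x ≤ w x := by
    intro x
    have := hl0 x
    by_cases h1 : x ∈ B <;> by_cases h2 : a < l x <;> simp [hu, hv, hw, h1, h2, this]
  have hv2 : MemLp v 2 g := by
    refine MemLp.of_bound hvi.1 a (ae_of_all _ fun x => ?_)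
    rw [Real.norm_of_nonneg (hv0 x)]; exact hva x
  have hsq : ∫ x, v x ^ 2 ∂g ≤ a := by
    calc ∫ x, v x ^ 2 ∂g ≤ ∫ x, a * l x ∂g :=
          integral_mono hv2.integrable_sq (hl.const_mul a)
            (fun x => by simp only; nlinarith [hv0 x, hva x, hvl x])
      _ = a := by rw [integral_const_mul, hl1, mul_one]
  have hpq : |∫ x, v x ∂g - ∫ x, u x ∂g| ≤ ∫ x, w x ∂g := by
    rw [← integral_sub hvi hui]
    refine abs_integral_le_integral_abs.trans (integral_mono (hvi.sub hui).abs hwi fun x => ?_)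
    simp only
    rw [abs_sub_comm, abs_of_nonneg (huv x).1]
    exact (huv x).2
  have hkey := integral_abs_average_sub_le hn hv2
  have hiv : Integrable (fun y : Fin n → α => |(1 / (n : ℝ)) * ∑ i, v (y i) - ∫ x, v x ∂g|) P :=
    ((integrable_average_pi hvi).sub (integrable_const _)).abs
  calc ∫ y : Fin n → α, |(1 / (n : ℝ)) * ∑ i, u (y i) - ∫ x, u x ∂g| ∂P
      ≤ ∫ y : Fin n → α, ((1 / (n : ℝ)) * ∑ i, w (y i)
          + |(1 / (n : ℝ)) * ∑ i, v (y i) - ∫ x, v x ∂g| + ∫ x, w x ∂g) ∂P := by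
        refine integral_mono ((integrable_average_pi hui).sub (integrable_const _)).abs
          (((integrable_average_pi hwi).add hiv).add (integrable_const _)) fun y => ?_
        simp only
        have h1 : |(1 / (n : ℝ)) * ∑ i, u (y i) - (1 / (n : ℝ)) * ∑ i, v (y i)|
            ≤ (1 / (n : ℝ)) * ∑ i, w (y i) := by
          rw [← mul_sub, ← Finset.sum_sub_distrib, abs_of_nonneg
            (mul_nonneg (by positivity) (Finset.sum_nonneg fun i _ => (huv (y i)).1))]
          gcongr
          exact (huv _).2
        calc |(1 / (n : ℝ)) * ∑ i, u (y i) - ∫ x, u x ∂g|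
            = |((1 / (n : ℝ)) * ∑ i, u (y i) - (1 / (n : ℝ)) * ∑ i, v (y i)) +
              ((1 / (n : ℝ)) * ∑ i, v (y i) - ∫ x, v x ∂g) +
              (∫ x, v x ∂g - ∫ x, u x ∂g)| := by ring_nf
          _ ≤ _ := (abs_add_three _ _ _).trans (by gcongr)
    _ = 2 * ∫ x, w x ∂g
        + ∫ y : Fin n → α, |(1 / (n : ℝ)) * ∑ i, v (y i) - ∫ x, v x ∂g| ∂P := by
        have hadd : Integrable (fun y : Fin n → α => (1 / (n : ℝ)) * ∑ i, w (y i)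
            + |(1 / (n : ℝ)) * ∑ i, v (y i) - ∫ x, v x ∂g|) P := (integrable_average_pi hwi).add hiv
        rw [integral_add hadd (integrable_const _),
          integral_add (integrable_average_pi hwi) hiv, integral_average_pi hn hwi]
        simp
        ring
    _ ≤ _ := by
        gcongr
        refine hkey.trans (Real.sqrt_le_sqrt ?_)
        gcongr

/-- The maximum is at most `a` plus the sum of the weights above `a`, while the sum of all weights
is at least `n / 2` unless their average is far from its mean `1`. Of the factor `6`, two units come
from the maximum and four from twice the preceding `L¹` bound. -/
lemma integral_iSup_div_sum_le (hlm : Measurable l) (hl0 : ∀ x, 0 ≤ l x)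
    (hl : Integrable l g) (hl1 : ∫ x, l x ∂g = 1) {n : ℕ} (hn : n ≠ 0) {a : ℝ} (ha : 0 ≤ a) :
    ∫ y : Fin n → α, (⨆ i, l (y i)) / ∑ i, l (y i) ∂(Measure.pi fun _ => g)
      ≤ 2 * a / n + 6 * ∫ x, {x | a < l x}.indicator l x ∂g + 2 * √(a / n) := by
  set P := Measure.pi fun _ : Fin n => g
  have hT : MeasurableSet {x | a < l x} := measurableSet_lt measurable_const hlm
  have hmean := integral_abs_average_sub_le_of_tail hlm hl0 hl hl1 MeasurableSet.univ hn ha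
  simp only [Set.indicator_univ, hl1] at hmean
  set w := {x | a < l x}.indicator l with hw
  have hwi : Integrable w g := hl.indicator hT
  have hw0 : ∀ x, 0 ≤ w x := fun x => Set.indicator_nonneg (fun x _ => hl0 x) x
  have hlw : ∀ x, l x ≤ a + w x := by
    intro x
    by_cases h2 : a < l x
    · simp [hw, h2, ha]
    · simpa [hw, h2] using not_lt.1 h2
  have : Nonempty (Fin n) := ⟨⟨0, Nat.pos_of_ne_zero hn⟩⟩
  have hn0 : (0 : ℝ) < n := by positivity
  have hi1 : Integrable (fun y : Fin n → α => |(1 / (n : ℝ)) * ∑ i, l (y i) - 1|) P :=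
    ((integrable_average_pi hl).sub (integrable_const _)).abs
  have hi2 := integrable_average_pi (n := n) hwi
  have hm0 : ∀ y : Fin n → α, 0 ≤ ⨆ i, l (y i) := fun y => Real.iSup_nonneg fun i => hl0 _
  have hs0 : ∀ y : Fin n → α, 0 ≤ ∑ i, l (y i) := fun y => Finset.sum_nonneg fun i _ => hl0 _
  calc ∫ y : Fin n → α, (⨆ i, l (y i)) / ∑ i, l (y i) ∂P
      ≤ ∫ y : Fin n → α, (2 * a / n + 2 * ((1 / (n : ℝ)) * ∑ i, w (y i))
          + 2 * |(1 / (n : ℝ)) * ∑ i, l (y i) - 1|) ∂P := by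
        refine integral_mono_of_nonneg (ae_of_all _ fun y => div_nonneg (hm0 y) (hs0 y))
          (((integrable_const _).add (hi2.const_mul 2)).add (hi1.const_mul 2))
          (ae_of_all _ fun y => ?_)
        simp only
        have hW : 0 ≤ ∑ i, w (y i) := Finset.sum_nonneg fun i _ => hw0 _
        have hms : ⨆ i, l (y i) ≤ ∑ i, l (y i) := ciSup_le fun i =>
          Finset.single_le_sum (f := fun i => l (y i)) (fun i _ => hl0 _) (Finset.mem_univ i)
        have hma : ⨆ i, l (y i) ≤ a + ∑ i, w (y i) := ciSup_le fun i =>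
          (hlw (y i)).trans (by
            gcongr
            exact Finset.single_le_sum (f := fun i => w (y i)) (fun i _ => hw0 _)
              (Finset.mem_univ i))
        set m := ⨆ i, l (y i)
        set s := ∑ i, l (y i)
        set W := ∑ i, w (y i)
        have hm := hm0 y
        by_cases hs : (n : ℝ) / 2 ≤ s
        · have h1 : m / s ≤ (a + W) / (n / 2) := by gcongr
          have h2 : (a + W) / ((n : ℝ) / 2) = 2 * a / n + 2 * (1 / n * W) := by field_simp
          have h3 := abs_nonneg (1 / (n : ℝ) * s - 1)
          linarith
        -- The average is now below `1/2`, so `2 * |average - 1|` exceeds `1` and absorbs the ratio.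
        · push Not at hs
          have h1 : m / s ≤ 1 := div_le_one_of_le₀ hms (hs0 y)
          have h2 : 1 / (n : ℝ) * s < 1 / 2 := by
            rw [one_div, inv_mul_lt_iff₀ hn0]; linarith
          have h3 := neg_abs_le (1 / (n : ℝ) * s - 1)
          have h4 : 0 ≤ 2 * a / n := by positivity
          have h5 : 0 ≤ 2 * (1 / (n : ℝ) * W) := by positivity
          linarith
    _ = 2 * a / n + 2 * ∫ x, w x ∂g
        + 2 * ∫ y : Fin n → α, |(1 / (n : ℝ)) * ∑ i, l (y i) - 1| ∂P := by
        have hadd : Integrable (fun y : Fin n → α => 2 * a / n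
            + 2 * ((1 / (n : ℝ)) * ∑ i, w (y i))) P := (integrable_const _).add (hi2.const_mul 2)
        have hw2 : ∫ y : Fin n → α, 2 * ((1 / (n : ℝ)) * ∑ i, w (y i)) ∂P = 2 * ∫ x, w x ∂g := by
          rw [integral_const_mul, integral_average_pi hn hwi]
        rw [integral_add hadd (hi1.const_mul 2),
          integral_add (integrable_const _) (hi2.const_mul 2), hw2, integral_const_mul]
        simp
    _ ≤ _ := by linarith

end ImportanceSampling

/-! ### Tail of the likelihood ratio via relative entropy. -/

section Tail

variable {E : Type*} [NormedAddCommGroup E] [InnerProductSpace ℝ E] [FiniteDimensional ℝ E]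
  [MeasurableSpace E] [BorelSpace E]

lemma memLp_two_affine_stdGaussian (μ : E) (M : E →L[ℝ] E) :
    MemLp (fun x => M (x - μ)) 2 (stdGaussian E) := by
  have : MemLp (fun x : E => x - μ) 2 (stdGaussian E) :=
    (IsGaussian.memLp_two_id (μ := stdGaussian E)).sub (memLp_const μ)
  exact M.comp_memLp' this

lemma integrable_logLR (μ : E) (M : E →L[ℝ] E) : Integrable (logLR μ M) (stdGaussian E) := by
  have h1 := (memLp_two_affine_stdGaussian μ M).integrable_norm_pow (by norm_num)
  have h2 := (IsGaussian.memLp_two_id (μ := stdGaussian E)).integrable_norm_pow (by norm_num)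
  exact ((integrable_const _).add (h1.div_const 2)).sub (h2.div_const 2)

lemma stdGaussian_absolutelyContinuous_map_affine (μ : E) {L M : E →L[ℝ] E}
    (h1 : ∀ x, L (M x) = x) (h2 : ∀ x, M (L x) = x) :
    stdGaussian E ≪ (stdGaussian E).map (fun z => μ + L z) := by
  rw [stdGaussian_map_affine μ h1 h2]
  refine withDensity_absolutelyContinuous' (by fun_prop) (ae_of_all _ fun x => ?_)
  simp [Real.exp_pos]

/-- A bound on the upper tail of the likelihood ratio by the relative entropy. -/
lemma integral_indicator_rnDeriv_le (μ : E) {L M : E →L[ℝ] E}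
    (h1 : ∀ x, L (M x) = x) (h2 : ∀ x, M (L x) = x) {t : ℝ} (ht : 0 < t) :
    ∫ x, {x | Real.exp t <
        ((stdGaussian E).rnDeriv ((stdGaussian E).map fun z => μ + L z) x).toReal}.indicator
      (fun x => ((stdGaussian E).rnDeriv ((stdGaussian E).map fun z => μ + L z) x).toReal) x
      ∂((stdGaussian E).map fun z => μ + L z)
      ≤ (∫ x, logLR μ M x ∂(stdGaussian E) + 1) / t := by
  set f := stdGaussian E
  set g := f.map fun z => μ + L z with hg
  have : IsProbabilityMeasure g := Measure.isProbabilityMeasure_map (by fun_prop)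
  have hac : f ≪ g := stdGaussian_absolutelyContinuous_map_affine μ h1 h2
  have hm : MeasurableSet {x | Real.exp t < (f.rnDeriv g x).toReal} :=
    measurableSet_lt measurable_const (Measure.measurable_rnDeriv f g).ennreal_toReal
  rw [integral_indicator hm, Measure.setIntegral_toReal_rnDeriv hac, le_div_iff₀ ht]
  obtain ⟨hi, hi1⟩ := integral_exp_neg_logLR μ h1 h2
  have hk := integrable_logLR μ M
  -- Markov needs a nonnegative function, and `logLR` may be negative. Adding `exp (-logLR)` repairs
  -- this because `u + exp (-u) ≥ 1`; its integral is `1`, whence the `+ 1` in the bound.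
  have hmarkov := mul_meas_ge_le_integral_of_nonneg (μ := f)
    (f := fun x => logLR μ M x + Real.exp (-logLR μ M x))
    (ae_of_all _ fun x => by
      have := Real.add_one_le_exp (-logLR μ M x)
      simp only [Pi.zero_apply]; linarith) (hk.add hi) t
  rw [integral_add hk hi, hi1] at hmarkov
  rw [mul_comm]
  refine le_trans ?_ hmarkov
  refine mul_le_mul_of_nonneg_left
    (ENNReal.toReal_mono (measure_ne_top f _) (measure_mono_ae ?_)) ht.le
  filter_upwards [hac.ae_le (rnDeriv_stdGaussian_map_affine μ h1 h2)] with x hx hlt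
  have hlt' : Real.exp t < (f.rnDeriv g x).toReal := hlt
  rw [hx, ENNReal.toReal_ofReal (Real.exp_pos _).le, Real.exp_lt_exp] at hlt'
  exact hlt'.le.trans (le_add_of_nonneg_right (Real.exp_pos _).le)

end Tail

/-! ### Efficiency from bounded relative entropy. -/

lemma weightRatio_nonneg {d : ℕ+} (f g : Measure (Euc d)) (n : ℕ) : 0 ≤ weightRatio f g n :=
  integral_nonneg fun _ => div_nonneg (Real.iSup_nonneg fun _ => ENNReal.toReal_nonneg)
    (Finset.sum_nonneg fun _ _ => ENNReal.toReal_nonneg)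

lemma isError_nonneg {d : ℕ+} (f g : Measure (Euc d)) (A : Set (Euc d)) (n : ℕ) :
    0 ≤ isError f g A n :=
  integral_nonneg fun _ => abs_nonneg _

/-- Efficiency for auxiliary Gaussians of bounded relative entropy, uniformly in the dimension. -/
lemma exists_forall_weightRatio_isError_le (K : ℝ) {p ε : ℝ} (hp : 0 < p) (hε : 0 < ε) :
    ∃ N : ℕ, ∀ (d : ℕ+) (μ : Euc d) (L M : Euc d →L[ℝ] Euc d), (∀ x, L (M x) = x) →
      (∀ x, M (L x) = x) → ∫ x, logLR μ M x ∂(stdN d) ≤ K → ∀ n, N ≤ n →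
      weightRatio (stdN d) ((stdN d).map fun z => μ + L z) n ≤ ε ∧
      ∀ A, MeasurableSet A → p ≤ (stdN d).real A →
        isError (stdN d) ((stdN d).map fun z => μ + L z) A n ≤ ε := by
  -- The truncation level `exp t` makes each tail contribution at most `ε / 2`. It does not depend
  -- on `d`, so neither does the `N` that handles the terms in `exp t / n`.
  set t : ℝ := max 1 (max (12 * (K + 1) / ε) (4 * (K + 1) / (p * ε))) with ht
  have ht0 : 0 < t := lt_of_lt_of_le one_pos (le_max_left _ _)
  have ht1 : 6 * ((K + 1) / t) ≤ ε / 2 := by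
    have : 12 * (K + 1) / ε ≤ t := (le_max_left _ _).trans (le_max_right _ _)
    rw [div_le_iff₀ hε] at this
    rw [← mul_div_assoc, div_le_iff₀ ht0]; linarith
  have ht2 : 2 * ((K + 1) / t) / p ≤ ε / 2 := by
    have : 4 * (K + 1) / (p * ε) ≤ t := (le_max_right _ _).trans (le_max_right _ _)
    rw [div_le_iff₀ (by positivity)] at this
    rw [← mul_div_assoc, div_div, div_le_iff₀ (by positivity)]; linarith
  have hlim1 : Tendsto (fun n : ℕ => 2 * Real.exp t / n + 2 * √(Real.exp t / n)) atTop (𝓝 0) := by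
    have e1 := tendsto_const_div_atTop_nhds_zero_nat (2 * Real.exp t)
    have e2 := (tendsto_const_div_atTop_nhds_zero_nat (Real.exp t)).sqrt.const_mul 2
    simpa using e1.add e2
  have hlim2 : Tendsto (fun n : ℕ => √(Real.exp t / n) / p) atTop (𝓝 0) := by
    have e2 := (tendsto_const_div_atTop_nhds_zero_nat (Real.exp t)).sqrt.div_const p
    simpa using e2
  have hev := ((hlim1.eventually_le_const (half_pos hε)).and
    (hlim2.eventually_le_const (half_pos hε))).and (eventually_ne_atTop 0)
  obtain ⟨N, hN⟩ := eventually_atTop.1 hev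
  refine ⟨N, fun d μ L M h1 h2 hK n hn => ?_⟩
  obtain ⟨⟨hn1, hn2⟩, hn0⟩ := hN n hn
  set f := stdN d
  set g := f.map fun z => μ + L z with hg
  have : IsProbabilityMeasure g := Measure.isProbabilityMeasure_map (by fun_prop)
  have hac : f ≪ g := stdGaussian_absolutelyContinuous_map_affine μ h1 h2
  have hlm : Measurable (likelihoodRatio f g) :=
    (Measure.measurable_rnDeriv f g).ennreal_toReal
  have hl0 : ∀ x, 0 ≤ likelihoodRatio f g x := fun x => ENNReal.toReal_nonneg
  have hli : Integrable (likelihoodRatio f g) g := Measure.integrable_toReal_rnDeriv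
  have hl1 : ∫ x, likelihoodRatio f g x ∂g = 1 := by
    unfold likelihoodRatio
    rw [Measure.integral_toReal_rnDeriv hac]; simp
  have htail : ∫ x, {x | Real.exp t < likelihoodRatio f g x}.indicator (likelihoodRatio f g) x ∂g
      ≤ (K + 1) / t :=
    (integral_indicator_rnDeriv_le μ h1 h2 ht0).trans (by gcongr)
  constructor
  · have := integral_iSup_div_sum_le hlm hl0 hli hl1 hn0 (Real.exp_pos t).le
    unfold weightRatio
    linarith
  · intro A hA hpA
    have hpA0 : 0 < f.real A := hp.trans_le hpA
    have h := integral_abs_average_sub_le_of_tail hlm hl0 hli hl1 hA hn0 (Real.exp_pos t).le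
    have hiA : ∫ x, A.indicator (likelihoodRatio f g) x ∂g = f.real A := by
      rw [integral_indicator hA]
      exact Measure.setIntegral_toReal_rnDeriv hac A
    rw [hiA] at h
    have he : isError f g A n = (∫ y : Fin n → Euc d,
        |(1 / (n : ℝ)) * ∑ i, A.indicator (likelihoodRatio f g) (y i) - f.real A|
        ∂(Measure.pi fun _ => g)) / f.real A := by
      unfold isError
      rw [← integral_div]
      congr 1
      ext y
      have : isEstimator f g A n y =
          (1 / (n : ℝ)) * ∑ i, A.indicator (likelihoodRatio f g) (y i) := by
        unfold isEstimator
        congr 2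
        ext i
        by_cases hi : y i ∈ A <;> simp [hi]
      rw [this, div_sub_one hpA0.ne', abs_div, abs_of_pos hpA0]
    rw [he]
    have hnn := integral_nonneg (μ := Measure.pi fun _ : Fin n => g)
      (f := fun y : Fin n → Euc d =>
        |(1 / (n : ℝ)) * ∑ i, A.indicator (likelihoodRatio f g) (y i) - f.real A|)
      fun y => abs_nonneg _
    refine (div_le_div_of_nonneg_left hnn hp hpA).trans ?_
    calc _ ≤ (2 * ((K + 1) / t) + √(Real.exp t / n)) / p :=
        div_le_div_of_nonneg_right (h.trans (by linarith)) hp.le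
      _ ≤ ε := by rw [add_div]; linarith

/-! ### Relative entropy of Gaussians in terms of the covariance matrix. -/

section Matrices

open Matrix
open scoped MatrixOrder

variable {ι : Type*} [Fintype ι] [DecidableEq ι]

/-- The square root of `S` as an operator on Euclidean space. -/
def sqrtCLM (S : Matrix ι ι ℝ) : EuclideanSpace ℝ ι →L[ℝ] EuclideanSpace ℝ ι :=
  toEuclideanCLM (𝕜 := ℝ) (CFC.sqrt S)

/-- The inverse square root of `S` as an operator on Euclidean space. -/
def invSqrtCLM (S : Matrix ι ι ℝ) : EuclideanSpace ℝ ι →L[ℝ] EuclideanSpace ℝ ι :=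
  toEuclideanCLM (𝕜 := ℝ) (CFC.sqrt S)⁻¹

lemma det_toEuclideanCLM (R : Matrix ι ι ℝ) : (toEuclideanCLM (𝕜 := ℝ) R).det = R.det := by
  rw [ContinuousLinearMap.det, coe_toEuclideanCLM_eq_toEuclideanLin,
    toEuclideanLin_eq_toLin_orthonormal, LinearMap.det_toLin]

variable {S : Matrix ι ι ℝ}

lemma isUnit_det_sqrt (hS : S.PosDef) : IsUnit (CFC.sqrt S).det := by
  have h := CFC.sqrt_mul_sqrt_self S hS.posSemidef.nonneg
  have h2 := congrArg Matrix.det h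
  rw [Matrix.det_mul] at h2
  rw [isUnit_iff_ne_zero]
  intro h0
  rw [h0, zero_mul] at h2
  exact hS.det_pos.ne h2

lemma sqrtCLM_invSqrtCLM (hS : S.PosDef) (x : EuclideanSpace ℝ ι) :
    sqrtCLM S (invSqrtCLM S x) = x := by
  rw [sqrtCLM, invSqrtCLM, ← mul_apply_eq_comp, ← map_mul,
    Matrix.mul_nonsing_inv _ (isUnit_det_sqrt hS), map_one, one_apply_eq_self]

lemma invSqrtCLM_sqrtCLM (hS : S.PosDef) (x : EuclideanSpace ℝ ι) :
    invSqrtCLM S (sqrtCLM S x) = x := by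
  rw [sqrtCLM, invSqrtCLM, ← mul_apply_eq_comp, ← map_mul,
    Matrix.nonsing_inv_mul _ (isUnit_det_sqrt hS), map_one, one_apply_eq_self]

lemma log_abs_det_invSqrtCLM (hS : S.PosDef) :
    Real.log |(invSqrtCLM S).det| = -(Real.log S.det / 2) := by
  have h := congrArg Matrix.det (CFC.sqrt_mul_sqrt_self S hS.posSemidef.nonneg)
  rw [Matrix.det_mul, ← sq] at h
  rw [invSqrtCLM, det_toEuclideanCLM, Matrix.det_nonsing_inv, Ring.inverse_eq_inv', Real.log_abs,
    Real.log_inv, ← h, Real.log_pow]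
  push_cast
  ring

lemma norm_sq_invSqrtCLM (hS : S.PosDef) (x : EuclideanSpace ℝ ι) :
    ‖invSqrtCLM S x‖ ^ 2 = x.ofLp ⬝ᵥ (S⁻¹ *ᵥ x.ofLp) := by
  have hsa : IsSelfAdjoint (CFC.sqrt S) := (CFC.sqrt_nonneg S).isSelfAdjoint
  have hsymm : (CFC.sqrt S)⁻¹ᵀ = (CFC.sqrt S)⁻¹ := by
    rw [Matrix.transpose_nonsing_inv]
    congr 1
  have hinv : S⁻¹ = (CFC.sqrt S)⁻¹ * (CFC.sqrt S)⁻¹ := by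
    rw [← Matrix.mul_inv_rev, CFC.sqrt_mul_sqrt_self S hS.posSemidef.nonneg]
  have hn : ‖invSqrtCLM S x‖ ^ 2 = (invSqrtCLM S x).ofLp ⬝ᵥ (invSqrtCLM S x).ofLp := by
    rw [EuclideanSpace.real_norm_sq_eq, dotProduct]
    exact Finset.sum_congr rfl fun i _ => sq _
  rw [hn, invSqrtCLM, ofLp_toEuclideanCLM, hinv, ← Matrix.mulVec_mulVec,
    Matrix.dotProduct_mulVec x.ofLp, ← Matrix.mulVec_transpose, hsymm]

lemma logLR_invSqrtCLM (hS : S.PosDef) (μ x : EuclideanSpace ℝ ι) :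
    logLR μ (invSqrtCLM S) x = (Real.log S.det
      + (x - μ).ofLp ⬝ᵥ (S⁻¹ *ᵥ (x - μ).ofLp) - ∑ i, x i ^ 2) / 2 := by
  rw [logLR, log_abs_det_invSqrtCLM hS, norm_sq_invSqrtCLM hS, EuclideanSpace.real_norm_sq_eq]
  ring

/-- A general `Q` is allowed because this serves both the standard Gaussian and its conditioned
version. -/
lemma integral_dotProduct_mulVec {Q : Measure (EuclideanSpace ℝ ι)} [IsFiniteMeasure Q]
    (hQ : MemLp id 2 Q) (μ : EuclideanSpace ℝ ι) (B : Matrix ι ι ℝ) :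
    ∫ x, (x - μ).ofLp ⬝ᵥ (B *ᵥ (x - μ).ofLp) ∂Q
      = ∑ i, ∑ j, B i j * ∫ x, (x i - μ i) * (x j - μ j) ∂Q := by
  have hc : ∀ i, MemLp (fun x : EuclideanSpace ℝ ι => x i - μ i) 2 Q := fun i =>
    ((EuclideanSpace.proj (𝕜 := ℝ) i).comp_memLp' hQ).sub (memLp_const (μ i))
  have hint : ∀ i j, Integrable
      (fun x : EuclideanSpace ℝ ι => (x - μ).ofLp i * (B i j * (x - μ).ofLp j)) Q := fun i j => by
    refine (((hc i).integrable_mul (hc j)).const_mul (B i j)).congr (ae_of_all _ fun x => ?_)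
    simp only [PiLp.sub_apply, Pi.mul_apply]; ring
  simp only [dotProduct, mulVec, Finset.mul_sum]
  rw [integral_finsetSum _ fun i _ => integrable_finsetSum _ fun j _ => hint i j]
  refine Finset.sum_congr rfl fun i _ => ?_
  rw [integral_finsetSum _ fun j _ => hint i j]
  refine Finset.sum_congr rfl fun j _ => ?_
  rw [← integral_const_mul]
  refine integral_congr_ae (ae_of_all _ fun x => ?_)
  simp only [PiLp.sub_apply]; ring

lemma memLp_coord_stdGaussian (i : ι) :
    MemLp (fun x : EuclideanSpace ℝ ι => x i) 2 (stdGaussian (EuclideanSpace ℝ ι)) :=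
  (EuclideanSpace.proj (𝕜 := ℝ) i).comp_memLp' IsGaussian.memLp_two_id

lemma integral_coord_stdGaussian (i : ι) :
    ∫ x, x i ∂(stdGaussian (EuclideanSpace ℝ ι)) = 0 :=
  integral_strongDual_stdGaussian (EuclideanSpace.proj (𝕜 := ℝ) i)

lemma integral_coord_mul_coord_stdGaussian (i j : ι) :
    ∫ x, x i * x j ∂(stdGaussian (EuclideanSpace ℝ ι)) = (1 : Matrix ι ι ℝ) i j := by
  have h := covariance_eval_multivariateGaussian (μ := (0 : EuclideanSpace ℝ ι))
    (PosSemidef.one (n := ι) (R := ℝ)) i j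
  rw [multivariateGaussian_zero_one,
    covariance_eq_sub (memLp_coord_stdGaussian i) (memLp_coord_stdGaussian j),
    integral_coord_stdGaussian, zero_mul, sub_zero] at h
  exact h

lemma integral_sub_mul_sub_stdGaussian (μ : EuclideanSpace ℝ ι) (i j : ι) :
    ∫ x, (x i - μ i) * (x j - μ j) ∂(stdGaussian (EuclideanSpace ℝ ι))
      = (1 : Matrix ι ι ℝ) i j + μ i * μ j := by
  have h1 : Integrable (fun x : EuclideanSpace ℝ ι => x i * x j)
    (stdGaussian (EuclideanSpace ℝ ι)) :=
    (memLp_coord_stdGaussian i).integrable_mul (memLp_coord_stdGaussian j)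
  have h2 := (memLp_coord_stdGaussian i).integrable one_le_two
  have h3 := (memLp_coord_stdGaussian j).integrable one_le_two
  have e : ∀ x : EuclideanSpace ℝ ι, (x i - μ i) * (x j - μ j)
      = x i * x j - μ j * x i - μ i * x j + μ i * μ j := fun x => by ring
  simp_rw [e]
  have h4 : Integrable (fun x : EuclideanSpace ℝ ι => x i * x j - μ j * x i)
    (stdGaussian (EuclideanSpace ℝ ι)) := h1.sub (h2.const_mul _)
  have h5 : Integrable (fun x : EuclideanSpace ℝ ι => x i * x j - μ j * x i - μ i * x j)
    (stdGaussian (EuclideanSpace ℝ ι)) := h4.sub (h3.const_mul _)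
  rw [integral_add h5 (integrable_const _), integral_sub h4 (h3.const_mul _),
    integral_sub h1 (h2.const_mul _), integral_const_mul, integral_const_mul,
    integral_coord_stdGaussian, integral_coord_stdGaussian, integral_coord_mul_coord_stdGaussian]
  simp

/-- The relative entropy of the standard Gaussian with respect to `N(μ, S)`. -/
lemma integral_logLR_stdGaussian (hS : S.PosDef) (μ : EuclideanSpace ℝ ι) :
    ∫ x, logLR μ (invSqrtCLM S) x ∂(stdGaussian (EuclideanSpace ℝ ι))
      = (Real.log S.det + S⁻¹.trace + μ.ofLp ⬝ᵥ (S⁻¹ *ᵥ μ.ofLp) - Fintype.card ι) / 2 := by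
  simp_rw [logLR_invSqrtCLM hS]
  have hsq : ∀ i, Integrable (fun x : EuclideanSpace ℝ ι => x i ^ 2)
    (stdGaussian (EuclideanSpace ℝ ι)) := fun i => (memLp_coord_stdGaussian i).integrable_sq
  have hsum : Integrable (fun x : EuclideanSpace ℝ ι => ∑ i, x i ^ 2)
    (stdGaussian (EuclideanSpace ℝ ι)) := integrable_finsetSum _ fun i _ => hsq i
  have hquad : Integrable
      (fun x : EuclideanSpace ℝ ι => (x - μ).ofLp ⬝ᵥ (S⁻¹ *ᵥ (x - μ).ofLp))
      (stdGaussian (EuclideanSpace ℝ ι)) := by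
    simp_rw [← norm_sq_invSqrtCLM hS]
    exact (memLp_two_affine_stdGaussian μ (invSqrtCLM S)).integrable_norm_pow (by norm_num)
  have hadd : Integrable
      (fun x : EuclideanSpace ℝ ι => Real.log S.det + (x - μ).ofLp ⬝ᵥ (S⁻¹ *ᵥ (x - μ).ofLp))
      (stdGaussian (EuclideanSpace ℝ ι)) := (integrable_const _).add hquad
  rw [integral_div, integral_sub hadd hsum, integral_add (integrable_const _) hquad,
    integral_dotProduct_mulVec IsGaussian.memLp_two_id, integral_finsetSum _ fun i _ => hsq i]
  simp_rw [integral_sub_mul_sub_stdGaussian, sq, integral_coord_mul_coord_stdGaussian]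
  have h1 : ∑ i, ∑ j, S⁻¹ i j * ((1 : Matrix ι ι ℝ) i j + μ i * μ j)
      = S⁻¹.trace + μ.ofLp ⬝ᵥ (S⁻¹ *ᵥ μ.ofLp) := by
    simp only [mul_add, Finset.sum_add_distrib]
    congr 1
    · simp [Matrix.one_apply, Matrix.trace]
    · simp only [dotProduct, mulVec, Finset.mul_sum]
      exact Finset.sum_congr rfl fun i _ => Finset.sum_congr rfl fun j _ => by ring
  rw [h1]
  simp
  ring

lemma posDef_of_lower_bound (hS : S.IsHermitian) {c : ℝ} (hc : 0 < c)
    (h : ∀ v : ι → ℝ, c * (v ⬝ᵥ v) ≤ v ⬝ᵥ (S *ᵥ v)) : S.PosDef := by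
  refine PosDef.of_dotProduct_mulVec_pos hS fun v hv => ?_
  have h0 : 0 < v ⬝ᵥ v := by
    have h1 : 0 ≤ v ⬝ᵥ v := Finset.sum_nonneg fun i _ => mul_self_nonneg _
    exact lt_of_le_of_ne h1 fun h2 => hv (dotProduct_self_eq_zero.1 h2.symm)
  rw [star_trivial]
  exact (mul_pos hc h0).trans_le (h v)

/-- With `u = S⁻¹ v`, the lower bound at `u` reads `c |u|² ≤ v ⬝ u`; insert it in `|v - c u|² ≥ 0`.
No diagonalisation is needed. -/
lemma dotProduct_inv_mulVec_le (hS : S.PosDef) {c : ℝ} (hc : 0 < c)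
    (h : ∀ v : ι → ℝ, c * (v ⬝ᵥ v) ≤ v ⬝ᵥ (S *ᵥ v)) (v : ι → ℝ) :
    v ⬝ᵥ (S⁻¹ *ᵥ v) ≤ (v ⬝ᵥ v) / c := by
  set u := S⁻¹ *ᵥ v with hu
  have hSu : S *ᵥ u = v := by
    rw [hu, mulVec_mulVec, mul_nonsing_inv _ (isUnit_iff_ne_zero.2 hS.det_pos.ne'), one_mulVec]
  have h1 := h u
  rw [hSu] at h1
  have h2 : 0 ≤ (v - c • u) ⬝ᵥ (v - c • u) := Finset.sum_nonneg fun i _ => mul_self_nonneg _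
  simp only [sub_dotProduct, dotProduct_sub, smul_dotProduct, dotProduct_smul, smul_eq_mul] at h2
  rw [dotProduct_comm u v] at h1 h2
  rw [le_div_iff₀ hc]
  nlinarith

lemma log_det_le (hS : S.PosDef) : Real.log S.det ≤ S.trace - Fintype.card ι := by
  have hd := hS.1.det_eq_prod_eigenvalues
  have ht := hS.1.trace_eq_sum_eigenvalues
  simp only [RCLike.ofReal_real_eq_id, id_eq] at hd ht
  rw [hd, ht, Real.log_prod fun i _ => (hS.eigenvalues_pos i).ne']
  calc ∑ i, Real.log (hS.1.eigenvalues i) ≤ ∑ i, (hS.1.eigenvalues i - 1) :=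
        Finset.sum_le_sum fun i _ => Real.log_le_sub_one_of_pos (hS.eigenvalues_pos i)
    _ = _ := by simp

/-- A bound on the relative entropy by the Frobenius distance of `S` to the identity. -/
lemma integral_logLR_stdGaussian_le (hS : S.IsHermitian) {c K : ℝ} (hc : 0 < c)
    (h : ∀ v : ι → ℝ, c * (v ⬝ᵥ v) ≤ v ⬝ᵥ (S *ᵥ v))
    (hF : ∑ i, ∑ j, (S - 1) i j ^ 2 ≤ K) (μ : EuclideanSpace ℝ ι) (hμ : ∑ i, μ i ^ 2 ≤ K) :
    ∫ x, logLR μ (invSqrtCLM S) x ∂(stdGaussian (EuclideanSpace ℝ ι)) ≤ K / c := by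
  have hpd := posDef_of_lower_bound hS hc h
  rw [integral_logLR_stdGaussian hpd]
  have hu : IsUnit S.det := isUnit_iff_ne_zero.2 hpd.det_pos.ne'
  have hlog := log_det_le hpd
  have hsym : ∀ i j, (S - 1) i j = (S - 1) j i := fun i j => by
    have := (hS.sub isHermitian_one).apply j i
    simpa using this
  -- Once `log det S` is replaced by `tr S - d`, the first-order terms cancel: `S⁻¹ + S - 2 = (S -
  -- 1) S⁻¹ (S - 1)`. The trace of the right side is a sum of `S⁻¹`-forms at the columns of `S - 1`.
  have htr : S⁻¹.trace + S.trace - 2 * Fintype.card ι ≤ K / c := by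
    have e : S⁻¹ + S - (1 + 1) = (S - 1) * (S⁻¹ * (S - 1)) := by
      rw [mul_sub S⁻¹, nonsing_inv_mul _ hu, mul_one, sub_mul, mul_sub S, mul_nonsing_inv _ hu,
        mul_one, one_mul]
      abel
    have e2 := congrArg Matrix.trace e
    simp only [trace_sub, trace_add, trace_one] at e2
    have e3 : ((S - 1) * (S⁻¹ * (S - 1))).trace
        = ∑ j, (fun i => (S - 1) i j) ⬝ᵥ (S⁻¹ *ᵥ fun i => (S - 1) i j) := by
      simp only [Matrix.trace, Matrix.diag_apply, Matrix.mul_apply (M := S - 1), dotProduct]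
      refine Finset.sum_congr rfl fun j _ => Finset.sum_congr rfl fun i _ => ?_
      rw [hsym j i]
      rfl
    calc S⁻¹.trace + S.trace - 2 * Fintype.card ι
        = S⁻¹.trace + S.trace - (Fintype.card ι + Fintype.card ι) := by ring
      _ = ∑ j, (fun i => (S - 1) i j) ⬝ᵥ (S⁻¹ *ᵥ fun i => (S - 1) i j) := e2.trans e3
      _ ≤ ∑ j, ((fun i => (S - 1) i j) ⬝ᵥ fun i => (S - 1) i j) / c :=
          Finset.sum_le_sum fun j _ => dotProduct_inv_mulVec_le hpd hc h _
      _ = (∑ i, ∑ j, (S - 1) i j ^ 2) / c := by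
          rw [← Finset.sum_div, Finset.sum_comm]
          simp only [dotProduct, sq]
      _ ≤ K / c := by gcongr
  have hmu : μ.ofLp ⬝ᵥ (S⁻¹ *ᵥ μ.ofLp) ≤ K / c := by
    refine (dotProduct_inv_mulVec_le hpd hc h _).trans ?_
    gcongr
    simpa only [dotProduct, sq] using hμ
  linarith

-- In eigenvalues the hypothesis bounds a sum of nonnegative terms `λ - 1 - log λ`, so each term is
-- at most `B`. Hence `log λ ≥ -1 - B`, and `(λ - 1)²` is at most a constant times the term, so that
-- the sum stays bounded whatever the dimension.
open Unitary in
lemma bounds_of_trace_sub_log_det_le (hS : S.PosDef) {B : ℝ}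
    (h : S.trace - Fintype.card ι - Real.log S.det ≤ B) :
    (∀ v : ι → ℝ, Real.exp (-1 - B) * (v ⬝ᵥ v) ≤ v ⬝ᵥ (S *ᵥ v)) ∧
      ∑ i, ∑ j, (S - 1) i j ^ 2 ≤ B * (2 + √B) ^ 2 := by
  have hd := hS.1.det_eq_prod_eigenvalues
  have ht := hS.1.trace_eq_sum_eigenvalues
  simp only [RCLike.ofReal_real_eq_id, id_eq] at hd ht
  have hsp := hS.1.spectral_theorem
  set l := hS.1.eigenvalues with hl
  have hpos : ∀ i, 0 < l i := hS.eigenvalues_pos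
  set U := hS.1.eigenvectorUnitary with hU
  simp only [RCLike.ofReal_real_eq_id, Function.id_comp] at hsp
  have hterm : ∀ i, 0 ≤ l i - 1 - Real.log (l i) := fun i => by
    have := Real.log_le_sub_one_of_pos (hpos i); linarith
  have hsum : ∑ i, (l i - 1 - Real.log (l i)) ≤ B := by
    rw [hd, ht, Real.log_prod fun i _ => (hpos i).ne'] at h
    simpa [Finset.sum_sub_distrib] using h
  have hB : 0 ≤ B := (Finset.sum_nonneg fun i _ => hterm i).trans hsum
  have hi : ∀ i, l i - 1 - Real.log (l i) ≤ B := fun i =>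
    (Finset.single_le_sum (f := fun i => l i - 1 - Real.log (l i)) (fun i _ => hterm i)
      (Finset.mem_univ i)).trans hsum
  constructor
  · intro v
    have hlow : ∀ i, 0 ≤ l i - Real.exp (-1 - B) := fun i => by
      have h1 : -1 - B ≤ Real.log (l i) := by linarith [hi i, hpos i]
      rw [sub_nonneg, ← Real.exp_log (hpos i)]
      exact Real.exp_le_exp.2 h1
    have hps : (S - Real.exp (-1 - B) • (1 : Matrix ι ι ℝ)).PosSemidef := by
      have e : S - Real.exp (-1 - B) • (1 : Matrix ι ι ℝ)
          = conjStarAlgAut ℝ _ U (diagonal fun i => l i - Real.exp (-1 - B)) := by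
        have e1 : (diagonal fun i => l i - Real.exp (-1 - B))
            = diagonal l - Real.exp (-1 - B) • (1 : Matrix ι ι ℝ) := by
          ext i j
          by_cases hij : i = j
          · subst hij; simp
          · simp [hij]
        rw [e1, map_sub, map_smul, map_one, ← hsp]
      rw [e, conjStarAlgAut_apply]
      exact (PosSemidef.diagonal hlow).mul_mul_conjTranspose_same _
    have := hps.dotProduct_mulVec_nonneg v
    rw [star_trivial, sub_mulVec, smul_mulVec, one_mulVec, dotProduct_sub, dotProduct_smul,
      smul_eq_mul] at this
    linarith
  · have hF : ∑ i, ∑ j, (S - 1) i j ^ 2 = ∑ i, (l i - 1) ^ 2 := by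
      have hsym : ∀ i j, (S - 1) i j = (S - 1) j i := fun i j => by
        have := (hS.1.sub isHermitian_one).apply j i
        simpa using this
      have e : (S - 1) * (S - 1) = conjStarAlgAut ℝ _ U (diagonal fun i => (l i - 1) ^ 2) := by
        have e1 : (diagonal fun i => (l i - 1) ^ 2)
            = (diagonal l - (1 : Matrix ι ι ℝ)) * (diagonal l - 1) := by
          rw [← diagonal_one, diagonal_sub, diagonal_mul_diagonal]
          simp only [sq]
        rw [e1, map_mul, map_sub, map_one, ← hsp]
      have e2 := congrArg Matrix.trace e
      have e3 : ((U : Matrix ι ι ℝ) * (diagonal fun i => (l i - 1) ^ 2)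
          * star (U : Matrix ι ι ℝ)).trace = ∑ i, (l i - 1) ^ 2 := by
        rw [trace_mul_comm, ← mul_assoc, Unitary.coe_star_mul_self, one_mul, trace_diagonal]
      rw [conjStarAlgAut_apply, e3] at e2
      rw [← e2]
      simp only [Matrix.trace, Matrix.diag_apply, Matrix.mul_apply]
      exact Finset.sum_congr rfl fun i _ => Finset.sum_congr rfl fun j _ => by
        rw [sq]; congr 1; exact hsym i j
    rw [hF]
    calc ∑ i, (l i - 1) ^ 2 ≤ ∑ i, (l i - 1 - Real.log (l i)) * (2 + √B) ^ 2 := by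
          refine Finset.sum_le_sum fun i _ => ?_
          have hs := Real.sq_sqrt (hpos i).le
          have hs0 := Real.sqrt_pos.2 (hpos i)
          -- Using `log x ≤ x - 1` at `√λ` instead of `λ` leaves the square `(√λ - 1)²` as a lower
          -- bound for the term; then `√λ + 1 ≤ 2 + √B` recovers `(λ - 1)²`.
          have hlog : Real.log (l i) ≤ 2 * (√(l i) - 1) := by
            have := Real.log_le_sub_one_of_pos hs0
            rw [Real.log_sqrt (hpos i).le] at this
            linarith
          have h1 : (√(l i) - 1) ^ 2 ≤ l i - 1 - Real.log (l i) := by nlinarith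
          have h2 : √(l i) - 1 ≤ √B := Real.le_sqrt_of_sq_le (h1.trans (hi i))
          have h3 : (l i - 1) ^ 2 = (√(l i) - 1) ^ 2 * (√(l i) + 1) ^ 2 := by
            rw [← mul_pow]; congr 1; nlinarith
          rw [h3]
          exact mul_le_mul h1 (pow_le_pow_left₀ (by positivity) (by linarith) 2)
            (by positivity) (hterm i)
      _ = (∑ i, (l i - 1 - Real.log (l i))) * (2 + √B) ^ 2 := by rw [Finset.sum_mul]
      _ ≤ _ := by gcongr

end Matrices

/-! ### Moments of the conditioned Gaussian. -/

section Conditioned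

open Matrix

lemma memLp_cond {α : Type*} [MeasurableSpace α] {f : Measure α} [IsFiniteMeasure f]
    {E : Type*} [NormedAddCommGroup E] {A : Set α} (hA : f A ≠ 0) {h : α → E} {q : ENNReal}
    (hh : MemLp h q f) : MemLp h q (cond f A) := by
  rw [ProbabilityTheory.cond]
  exact (hh.restrict A).smul_measure (ENNReal.inv_ne_top.2 hA)

lemma integrable_cond {α : Type*} [MeasurableSpace α] {f : Measure α} [IsFiniteMeasure f]
    {A : Set α} (hA : f A ≠ 0) {h : α → ℝ} (hh : Integrable h f) : Integrable h (cond f A) :=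
  memLp_one_iff_integrable.1 (memLp_cond hA (memLp_one_iff_integrable.2 hh))

/-- Conditioning multiplies the density by at most `1 / f(A)`. -/
lemma integral_cond_le {α : Type*} [MeasurableSpace α] {f : Measure α} [IsFiniteMeasure f]
    {A : Set α} {h : α → ℝ} (hh : Integrable h f) (h0 : ∀ x, 0 ≤ h x) :
    ∫ x, h x ∂(cond f A) ≤ (∫ x, h x ∂f) / f.real A := by
  rw [ProbabilityTheory.cond, integral_smul_measure, ENNReal.toReal_inv, smul_eq_mul,
    div_eq_inv_mul]
  exact mul_le_mul_of_nonneg_left (setIntegral_le_integral hh (ae_of_all _ h0)) (by positivity)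

variable {d : ℕ+} {A : Set (Euc d)}

lemma stdN_ne_zero_of_pos_le {p : ℝ} (hp : 0 < p) (hpA : p ≤ (stdN d).real A) :
    stdN d A ≠ 0 := fun h => by
  rw [measureReal_def, h, ENNReal.toReal_zero] at hpA
  exact absurd hpA (not_le.2 hp)

lemma memLp_two_id_cond (hp : stdN d A ≠ 0) : MemLp id 2 (cond (stdN d) A) :=
  memLp_cond hp IsGaussian.memLp_two_id

lemma memLp_coord_cond (hp : stdN d A ≠ 0) (i : Fin d) :
    MemLp (fun x : Euc d => x i) 2 (cond (stdN d) A) :=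
  memLp_cond hp (memLp_coord_stdGaussian i)

lemma condMean_apply (hp : stdN d A ≠ 0) (i : Fin d) :
    condMean A i = ∫ x, x i ∂(cond (stdN d) A) := by
  have := cond_isProbabilityMeasure hp
  exact ((EuclideanSpace.proj (𝕜 := ℝ) i).integral_comp_comm
    ((memLp_two_id_cond hp).integrable one_le_two)).symm

lemma condCov_isHermitian (A : Set (Euc d)) : (condCov A).IsHermitian := by
  ext i j
  simp [condCov, mul_comm]

lemma condCov_apply (hp : stdN d A ≠ 0) (i j : Fin d) :
    condCov A i j
      = ∫ x, (x i - condMean A i) * (x j - condMean A j) ∂(cond (stdN d) A) := by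
  have := cond_isProbabilityMeasure hp
  have h1 : Integrable (fun x : Euc d => x i * x j) (cond (stdN d) A) :=
    (memLp_coord_cond hp i).integrable_mul (memLp_coord_cond hp j)
  have h2 := (memLp_coord_cond hp i).integrable one_le_two
  have h3 := (memLp_coord_cond hp j).integrable one_le_two
  set m := condMean A
  have e : ∀ x : Euc d, (x i - m i) * (x j - m j)
      = x i * x j - m j * x i - m i * x j + m i * m j := fun x => by ring
  simp_rw [e]
  have h4 : Integrable (fun x : Euc d => x i * x j - m j * x i) (cond (stdN d) A) :=
    h1.sub (h2.const_mul _)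
  have h5 : Integrable (fun x : Euc d => x i * x j - m j * x i - m i * x j) (cond (stdN d) A) :=
    h4.sub (h3.const_mul _)
  rw [integral_add h5 (integrable_const _), integral_sub h4 (h3.const_mul _),
    integral_sub h1 (h2.const_mul _), integral_const_mul, integral_const_mul,
    ← condMean_apply hp, ← condMean_apply hp]
  simp [condCov]
  ring

/-- A zero of the quadratic form at `v ≠ 0` would be a vanishing variance, confining `f|_A` to a
hyperplane, which is Gaussian-null. -/
lemma condCov_posDef (hp : stdN d A ≠ 0) : (condCov A).PosDef := by
  have := cond_isProbabilityMeasure hp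
  refine PosDef.of_dotProduct_mulVec_pos (condCov_isHermitian A) fun v hv => ?_
  rw [star_trivial]
  set m := condMean A
  have hc : ∀ i, MemLp (fun x : Euc d => v i * (x i - m i)) 2 (cond (stdN d) A) := fun i =>
    ((memLp_coord_cond hp i).sub (memLp_const _)).const_mul _
  have hs : MemLp (fun x : Euc d => ∑ i, v i * (x i - m i)) 2 (cond (stdN d) A) :=
    memLp_finsetSum _ fun i _ => hc i
  have e : v ⬝ᵥ (condCov A *ᵥ v) = ∫ x, (∑ i, v i * (x i - m i)) ^ 2 ∂(cond (stdN d) A) := by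
    have hint : ∀ i j, Integrable
        (fun x : Euc d => (v i * (x i - m i)) * (v j * (x j - m j))) (cond (stdN d) A) :=
      fun i j => (hc i).integrable_mul (hc j)
    simp_rw [sq, Finset.sum_mul_sum]
    rw [integral_finsetSum _ fun i _ => integrable_finsetSum _ fun j _ => hint i j]
    simp only [dotProduct, mulVec, Finset.mul_sum]
    refine Finset.sum_congr rfl fun i _ => ?_
    rw [integral_finsetSum _ fun j _ => hint i j]
    refine Finset.sum_congr rfl fun j _ => ?_
    rw [condCov_apply hp, ← integral_mul_const, ← integral_const_mul]
    congr 1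
    ext x
    ring
  rw [e]
  refine lt_of_le_of_ne (integral_nonneg fun x => sq_nonneg _) fun h0 => ?_
  rw [eq_comm, integral_eq_zero_iff_of_nonneg (fun x => sq_nonneg _) hs.integrable_sq] at h0
  have hv' : WithLp.toLp 2 v ≠ (0 : Euc d) := fun h => hv (by simpa using congrArg WithLp.ofLp h)
  have hnull := stdGaussian_hyperplane_eq_zero hv' (inner ℝ (WithLp.toLp 2 v) m)
  have hac : cond (stdN d) A ≪ stdN d := cond_absolutelyContinuous
  have hone : cond (stdN d) A Set.univ = 0 := by
    rw [← nonpos_iff_eq_zero, ← hac hnull]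
    refine measure_mono_ae ?_
    filter_upwards [h0] with x hx _
    have hx' : ∑ i, v i * (x i - m i) = 0 := by simpa using hx
    change inner ℝ (WithLp.toLp 2 v) x = inner ℝ (WithLp.toLp 2 v) m
    rw [← sub_eq_zero, ← inner_sub_right, ← hx', PiLp.inner_apply]
    simp [mul_comm]
  simp at hone

/-- The Gibbs variational inequality for the Gaussian fitted to the conditioned distribution. -/
lemma trace_condCov_le (hp : stdN d A ≠ 0) :
    (condCov A).trace - d - Real.log (condCov A).det + ∑ i, condMean A i ^ 2
      ≤ -2 * Real.log ((stdN d).real A) := by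
  have := cond_isProbabilityMeasure hp
  have hS := condCov_posDef hp
  set S := condCov A
  set m := condMean A
  set Q := cond (stdN d) A
  have hp0 : 0 < (stdN d).real A := ENNReal.toReal_pos hp (measure_ne_top _ _)
  obtain ⟨hi, hi1⟩ := integral_exp_neg_logLR m (sqrtCLM_invSqrtCLM hS) (invSqrtCLM_sqrtCLM hS)
  have hk := integrable_cond hp (integrable_logLR m (invSqrtCLM S))
  have hexp := integral_cond_le (A := A) hi fun x => (Real.exp_pos _).le
  rw [hi1] at hexp
  -- Gibbs' inequality from `1 + u ≤ exp u` at `u = -logLR + log f(A)`. The right side is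
  -- nonpositive, because `f(A) • Q` is `f` restricted to `A` and `exp (-logLR)` has `f`-integral
  -- `1`.
  have hjensen : ∫ x, (-logLR m (invSqrtCLM S) x + Real.log ((stdN d).real A)) ∂Q
      ≤ ∫ x, ((stdN d).real A * Real.exp (-logLR m (invSqrtCLM S) x) - 1) ∂Q := by
    refine integral_mono (hk.neg.add (integrable_const _))
      (((integrable_cond hp hi).const_mul _).sub (integrable_const _)) fun x => ?_
    have := Real.add_one_le_exp (-logLR m (invSqrtCLM S) x + Real.log ((stdN d).real A))
    rw [Real.exp_add, Real.exp_log hp0] at this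
    simp only
    linarith
  have hkn : Integrable (fun x => -logLR m (invSqrtCLM S) x) Q := hk.neg
  rw [integral_add hkn (integrable_const _), integral_neg,
    integral_sub ((integrable_cond hp hi).const_mul _) (integrable_const _),
    integral_const_mul] at hjensen
  have hle : (stdN d).real A * ∫ x, Real.exp (-logLR m (invSqrtCLM S) x) ∂Q ≤ 1 := by
    calc _ ≤ (stdN d).real A * (1 / (stdN d).real A) := by gcongr
      _ = 1 := by field_simp
  have hsq : ∀ i, Integrable (fun x : Euc d => x i ^ 2) Q :=
    fun i => (memLp_coord_cond hp i).integrable_sq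
  have hsum : Integrable (fun x : Euc d => ∑ i, x i ^ 2) Q :=
    integrable_finsetSum _ fun i _ => hsq i
  have hquad : Integrable (fun x : Euc d => (x - m).ofLp ⬝ᵥ (S⁻¹ *ᵥ (x - m).ofLp)) Q := by
    simp_rw [← norm_sq_invSqrtCLM hS]
    exact integrable_cond hp
      ((memLp_two_affine_stdGaussian m (invSqrtCLM S)).integrable_norm_pow (by norm_num))
  have hadd : Integrable
      (fun x : Euc d => Real.log S.det + (x - m).ofLp ⬝ᵥ (S⁻¹ *ᵥ (x - m).ofLp)) Q :=
    (integrable_const _).add hquad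
  -- `logLR` is quadratic, so only the mean and covariance of `Q` enter. Since they are `m` and `S`,
  -- the `S⁻¹`-form integrates to `tr (S⁻¹ S) = d`.
  have hval : ∫ x, logLR m (invSqrtCLM S) x ∂Q
      = (Real.log S.det + d - (S.trace + ∑ i, m i ^ 2)) / 2 := by
    simp_rw [logLR_invSqrtCLM hS]
    have h4 : ∀ i j, ∫ x, (x i - m i) * (x j - m j) ∂Q = S i j := fun i j =>
      (condCov_apply hp i j).symm
    have h1 : ∑ i, ∑ j, S⁻¹ i j * S i j = d := by
      have h2 : (S⁻¹ * S).trace = d := by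
        rw [nonsing_inv_mul _ (isUnit_iff_ne_zero.2 hS.det_pos.ne')]; simp
      rw [← h2]
      simp only [Matrix.trace, Matrix.diag_apply, Matrix.mul_apply]
      refine Finset.sum_congr rfl fun i _ => Finset.sum_congr rfl fun j _ => ?_
      congr 1
      simpa using (condCov_isHermitian A).apply j i
    have h3 : ∀ i, ∫ x, x i ^ 2 ∂Q = S i i + m i ^ 2 := fun i => by
      simp only [S, m, condCov, Matrix.of_apply, sq]
      ring
    have hq : ∫ x, (x - m).ofLp ⬝ᵥ (S⁻¹ *ᵥ (x - m).ofLp) ∂Q = d := by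
      refine (integral_dotProduct_mulVec (memLp_two_id_cond hp) m S⁻¹).trans ?_
      rw [← h1]
      exact Finset.sum_congr rfl fun i _ => Finset.sum_congr rfl fun j _ =>
        congrArg _ (h4 i j)
    rw [integral_div, integral_sub hadd hsum, integral_add (integrable_const _) hquad, hq,
      integral_finsetSum _ fun i _ => hsq i]
    simp_rw [h3, Finset.sum_add_distrib]
    simp [Matrix.trace]
  rw [hval] at hjensen
  simp at hjensen
  linarith

/-- Moment bounds for the conditioned distribution, uniform in the dimension. -/
lemma condCov_bounds {p : ℝ} (hp : 0 < p) (hpA : p ≤ (stdN d).real A) :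
    (∀ v : Fin d → ℝ, Real.exp (-1 - -2 * Real.log p) * (v ⬝ᵥ v) ≤ v ⬝ᵥ (condCov A *ᵥ v)) ∧
      ∑ i, ∑ j, (condCov A - 1) i j ^ 2
        ≤ (-2 * Real.log p) * (2 + √(-2 * Real.log p)) ^ 2 ∧
      ∑ i, condMean A i ^ 2 ≤ -2 * Real.log p := by
  have hA0 : stdN d A ≠ 0 := stdN_ne_zero_of_pos_le hp hpA
  have h := trace_condCov_le hA0
  have hS := condCov_posDef hA0
  have hlog := log_det_le hS
  have hm : 0 ≤ ∑ i, condMean A i ^ 2 := Finset.sum_nonneg fun i _ => sq_nonneg _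
  have hlp := Real.log_le_log hp hpA
  simp only [Fintype.card_fin] at hlog
  have hb := bounds_of_trace_sub_log_det_le hS (B := -2 * Real.log p) (by
    simp only [Fintype.card_fin]; linarith)
  exact ⟨hb.1, hb.2, by linarith⟩

end Conditioned

/-! ### Stability of the entropy bound under small changes of the parameters. -/

section Perturbation

open Matrix

/-- The Frobenius norm dominates the operator norm, by two uses of Cauchy–Schwarz. -/
lemma abs_dotProduct_mulVec_le {ι : Type*} [Fintype ι] (E : Matrix ι ι ℝ) {r : ℝ} (hr : 0 ≤ r)
    (hE : ∑ i, ∑ j, E i j ^ 2 ≤ r ^ 2) (v : ι → ℝ) :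
    |v ⬝ᵥ (E *ᵥ v)| ≤ r * (v ⬝ᵥ v) := by
  have hv : v ⬝ᵥ v = ∑ i, v i ^ 2 := by simp only [dotProduct, sq]
  have h0 : 0 ≤ ∑ i, v i ^ 2 := Finset.sum_nonneg fun i _ => sq_nonneg _
  have h1 : (v ⬝ᵥ (E *ᵥ v)) ^ 2 ≤ (∑ i, v i ^ 2) * ∑ i, (E *ᵥ v) i ^ 2 :=
    Finset.sum_mul_sq_le_sq_mul_sq _ _ _
  have h2 : ∑ i, (E *ᵥ v) i ^ 2 ≤ r ^ 2 * ∑ i, v i ^ 2 := by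
    calc ∑ i, (E *ᵥ v) i ^ 2 ≤ ∑ i, (∑ j, E i j ^ 2) * ∑ j, v j ^ 2 :=
          Finset.sum_le_sum fun i _ => Finset.sum_mul_sq_le_sq_mul_sq _ _ _
      _ = (∑ i, ∑ j, E i j ^ 2) * ∑ j, v j ^ 2 := by rw [Finset.sum_mul]
      _ ≤ _ := by gcongr
  rw [hv]
  refine abs_le_of_sq_le_sq ?_ (by positivity)
  calc _ ≤ (∑ i, v i ^ 2) * (r ^ 2 * ∑ i, v i ^ 2) :=
        h1.trans (mul_le_mul_of_nonneg_left h2 h0)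
    _ = _ := by ring

lemma sum_add_sq_le {ι : Type*} (s : Finset ι) (a b : ι → ℝ) :
    ∑ i ∈ s, (a i + b i) ^ 2 ≤ 2 * ∑ i ∈ s, a i ^ 2 + 2 * ∑ i ∈ s, b i ^ 2 := by
  rw [Finset.mul_sum, Finset.mul_sum, ← Finset.sum_add_distrib]
  exact Finset.sum_le_sum fun i _ => by nlinarith [sq_nonneg (a i - b i)]

/-- Gaussians with parameters close to those of the conditioned distribution have bounded relative
entropy, uniformly in the dimension. -/
lemma exists_integral_logLR_le_of_near {p : ℝ} (hp : 0 < p) :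
    ∃ δ K : ℝ, 0 < δ ∧ ∀ (d : ℕ+) (A : Set (Euc d)), p ≤ (stdN d).real A →
      ∀ (μ : Euc d) (S : Matrix (Fin d) (Fin d) ℝ), S.IsHermitian →
        ∑ i, ∑ j, (S i j - condCov A i j) ^ 2 ≤ δ → ∑ i, (μ i - condMean A i) ^ 2 ≤ δ →
        S.PosDef ∧ ∫ x, logLR μ (invSqrtCLM S) x ∂(stdN d) ≤ K := by
  set B := -2 * Real.log p
  set c := Real.exp (-1 - B)
  have hc : 0 < c := Real.exp_pos _
  -- A Frobenius error of at most `c / 2` keeps half of the spectral lower bound `c`. The numerator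
  -- dominates both `‖S - 1‖_F²` and `|μ|²`, each bounded by `(a + b)² ≤ 2a² + 2b²`.
  refine ⟨(c / 2) ^ 2, (2 * (c / 2) ^ 2 + 2 * (B * (2 + √B) ^ 2) + 2 * B) / (c / 2),
    by positivity, fun d A hpA μ S hS hSA hμA => ?_⟩
  obtain ⟨h1, h2, h3⟩ := condCov_bounds hp hpA
  have hlow : ∀ v : Fin d → ℝ, c / 2 * (v ⬝ᵥ v) ≤ v ⬝ᵥ (S *ᵥ v) := fun v => by
    have h4 := abs_dotProduct_mulVec_le (S - condCov A) (r := c / 2) (by positivity)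
      (by simpa using hSA) v
    rw [sub_mulVec, dotProduct_sub] at h4
    have h5 := neg_le_of_abs_le h4
    have h6 := h1 v
    linarith
  have hB0 : 0 ≤ B := (Finset.sum_nonneg fun i _ => sq_nonneg _).trans h3
  have hF0 : 0 ≤ B * (2 + √B) ^ 2 := by positivity
  refine ⟨posDef_of_lower_bound hS (half_pos hc) hlow,
    integral_logLR_stdGaussian_le hS (half_pos hc) hlow ?_ μ ?_⟩
  · have e : ∑ i, ∑ j, (S - 1) i j ^ 2
        ≤ 2 * ∑ i, ∑ j, (S i j - condCov A i j) ^ 2 + 2 * ∑ i, ∑ j, (condCov A - 1) i j ^ 2 := by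
      simp only [← Finset.sum_product']
      convert sum_add_sq_le (Finset.univ ×ˢ Finset.univ)
        (fun q : Fin d × Fin d => S q.1 q.2 - condCov A q.1 q.2)
        (fun q => (condCov A - 1) q.1 q.2) using 4
      simp
    linarith
  · have e : ∑ i, μ i ^ 2 ≤ 2 * ∑ i, (μ i - condMean A i) ^ 2 + 2 * ∑ i, condMean A i ^ 2 := by
      convert sum_add_sq_le Finset.univ (fun i => μ i - condMean A i) (fun i => condMean A i)
        using 3
      ring
    linarith

/-- The squared distance between the empirical and true first and second moments of `f|_A`. -/
def momentDev {d : ℕ+} (A : Set (Euc d)) {n : ℕ} (y : Fin n → Euc d) : ℝ :=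
  ∑ i, ∑ j, ((1 / (n : ℝ)) * (∑ k, y k i * y k j) - ∫ x, x i * x j ∂(cond (stdN d) A)) ^ 2
    + ∑ i, ((1 / (n : ℝ)) * (∑ k, y k i) - ∫ x, x i ∂(cond (stdN d) A)) ^ 2

lemma empMean_apply {d : ℕ+} {n : ℕ} (y : Fin n → Euc d) (i : Fin d) :
    empMean y i = (1 / (n : ℝ)) * ∑ k, y k i := by
  simp [empMean]

lemma empCov_isHermitian {d : ℕ+} {n : ℕ} (y : Fin n → Euc d) : (empCov y).IsHermitian := by
  ext i j
  simp [empCov, mul_comm]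

/-- The quadratic form is an empirical variance. That this holds for every sample makes the matrix
square root continuous in `y` without exception. -/
lemma empCov_posSemidef {d : ℕ+} {n : ℕ} (y : Fin n → Euc d) : (empCov y).PosSemidef := by
  refine PosSemidef.of_dotProduct_mulVec_nonneg (empCov_isHermitian y) fun v => ?_
  rw [star_trivial]
  set s : Fin n → ℝ := fun k => ∑ i, v i * y k i with hs
  have e : v ⬝ᵥ (empCov y *ᵥ v)
      = (1 / (n : ℝ)) * ∑ k, s k ^ 2 - ((1 / (n : ℝ)) * ∑ k, s k) ^ 2 := by
    have e1 : (1 / (n : ℝ)) * ∑ k, s k ^ 2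
        = ∑ i, ∑ j, v i * ((1 / (n : ℝ)) * (∑ k, y k i * y k j) * v j) := by
      simp only [hs, sq, Finset.mul_sum, Finset.sum_mul]
      rw [Finset.sum_comm]
      refine Finset.sum_congr rfl fun i _ => ?_
      rw [Finset.sum_comm]
      exact Finset.sum_congr rfl fun j _ => Finset.sum_congr rfl fun k _ => by ring
    have e2 : (1 / (n : ℝ)) * ∑ k, s k = ∑ i, v i * empMean y i := by
      simp only [hs, empMean_apply, Finset.mul_sum]
      rw [Finset.sum_comm]
      exact Finset.sum_congr rfl fun i _ => Finset.sum_congr rfl fun j _ => by ring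
    rw [e1, e2, sq, Finset.sum_mul_sum, ← Finset.sum_sub_distrib]
    simp only [dotProduct, mulVec, Finset.mul_sum, ← Finset.sum_sub_distrib]
    refine Finset.sum_congr rfl fun i _ => Finset.sum_congr rfl fun j _ => ?_
    simp only [empCov, Matrix.of_apply, Finset.mul_sum]
    ring
  rw [e]
  rcases Nat.eq_zero_or_pos n with rfl | hn
  · simp
  · have hn0 : (0 : ℝ) < n := by exact_mod_cast hn
    have h := sq_sum_le_card_mul_sum_sq (s := Finset.univ) (f := s)
    simp only [Finset.card_univ, Fintype.card_fin] at h
    rw [mul_pow, sub_nonneg]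
    calc (1 / (n : ℝ)) ^ 2 * (∑ k, s k) ^ 2
        ≤ (1 / (n : ℝ)) ^ 2 * (n * ∑ k, s k ^ 2) := by gcongr
      _ = _ := by field_simp

/-- Raw moments are averages of i.i.d. variables, unlike the centred covariance. With `D` and `e`
the errors in second and first moments, the covariance error is `D - e eᵀ - e mᵀ - m eᵀ`. -/
lemma exists_integral_logLR_empCov_le {p : ℝ} (hp : 0 < p) :
    ∃ δ K : ℝ, 0 < δ ∧ ∀ (d : ℕ+) (A : Set (Euc d)), p ≤ (stdN d).real A →
      ∀ (n : ℕ) (y : Fin n → Euc d), momentDev A y ≤ δ →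
        (empCov y).PosDef ∧ ∫ x, logLR (empMean y) (invSqrtCLM (empCov y)) x ∂(stdN d) ≤ K := by
  obtain ⟨δ, K, hδ, h⟩ := exists_integral_logLR_le_of_near hp
  set B := -2 * Real.log p
  -- With `r ≤ 1` the quartic term in `e` is at most `r`, and `|m|² ≤ |B|`, so the squared
  -- covariance error is at most `4 (2 + 2|B|) r`.
  refine ⟨min (min 1 δ) (δ / (4 * (2 + 2 * |B|))), K,
    lt_min (lt_min one_pos hδ) (by positivity), fun d A hpA n y hy => ?_⟩
  have hA0 : stdN d A ≠ 0 := stdN_ne_zero_of_pos_le hp hpA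
  set r := momentDev A y with hr
  have hr1 : r ≤ 1 := hy.trans ((min_le_left _ _).trans (min_le_left _ _))
  have hr2 : r ≤ δ := hy.trans ((min_le_left _ _).trans (min_le_right _ _))
  have hr3 : 4 * (2 + 2 * |B|) * r ≤ δ := by
    have := hy.trans (min_le_right _ _)
    rw [le_div_iff₀ (by positivity)] at this
    linarith
  set D : Fin d → Fin d → ℝ := fun i j =>
    (1 / (n : ℝ)) * (∑ k, y k i * y k j) - ∫ x, x i * x j ∂(cond (stdN d) A) with hD
  set m := condMean A
  set e : Fin d → ℝ := fun i => empMean y i - m i with he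
  have hrD : r = ∑ i, ∑ j, D i j ^ 2 + ∑ i, e i ^ 2 := by
    simp only [hr, momentDev, hD, he, empMean_apply, m, condMean_apply hA0]
  have hD0 : 0 ≤ ∑ i, ∑ j, D i j ^ 2 :=
    Finset.sum_nonneg fun i _ => Finset.sum_nonneg fun j _ => sq_nonneg _
  have he0 : 0 ≤ ∑ i, e i ^ 2 := Finset.sum_nonneg fun i _ => sq_nonneg _
  have hm := (condCov_bounds hp hpA).2.2.trans (le_abs_self B)
  have hm0 : 0 ≤ ∑ i, m i ^ 2 := Finset.sum_nonneg fun i _ => sq_nonneg _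
  refine h d A hpA _ _ (empCov_isHermitian y) ?_ ?_
  · have hpt : ∀ i j, (empCov y i j - condCov A i j) ^ 2
        ≤ 4 * (D i j ^ 2 + e i ^ 2 * e j ^ 2 + e i ^ 2 * m j ^ 2 + m i ^ 2 * e j ^ 2) := by
      intro i j
      have : empCov y i j - condCov A i j = D i j - e i * e j - e i * m j - m i * e j := by
        simp only [empCov, condCov, Matrix.of_apply, hD, he, m]
        ring
      rw [this]
      nlinarith [sq_nonneg (D i j + e i * e j), sq_nonneg (D i j + e i * m j),
        sq_nonneg (D i j + m i * e j), sq_nonneg (e i * e j - e i * m j),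
        sq_nonneg (e i * e j - m i * e j), sq_nonneg (e i * m j - m i * e j)]
    calc ∑ i, ∑ j, (empCov y i j - condCov A i j) ^ 2
        ≤ ∑ i, ∑ j, 4 * (D i j ^ 2 + e i ^ 2 * e j ^ 2 + e i ^ 2 * m j ^ 2
          + m i ^ 2 * e j ^ 2) :=
          Finset.sum_le_sum fun i _ => Finset.sum_le_sum fun j _ => hpt i j
      _ = 4 * (∑ i, ∑ j, D i j ^ 2 + (∑ i, e i ^ 2) * (∑ i, e i ^ 2)
          + (∑ i, e i ^ 2) * (∑ i, m i ^ 2) + (∑ i, m i ^ 2) * (∑ i, e i ^ 2)) := by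
          rw [Finset.sum_mul_sum, Finset.sum_mul_sum, Finset.sum_mul_sum]
          simp only [← Finset.sum_add_distrib]
          simp only [Finset.mul_sum]
      _ ≤ 4 * (2 + 2 * |B|) * r := by
          rw [hrD] at hr1 ⊢
          have hB := abs_nonneg B
          nlinarith [mul_le_mul_of_nonneg_left hm he0, mul_nonneg hB hD0]
      _ ≤ δ := hr3
  · linarith

end Perturbation

/-! ### Concentration of the empirical moments. -/

section Empirical

/-- The fourth moment of the standard Gaussian distribution on the line. -/
def gaussFourthMoment : ℝ := ∫ x, x ^ 4 ∂(gaussianReal 0 1)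

lemma gaussFourthMoment_nonneg : 0 ≤ gaussFourthMoment :=
  integral_nonneg fun x => by positivity

variable {d : ℕ+}

lemma measurePreserving_coord_stdN (i : Fin d) :
    MeasurePreserving (fun x : Euc d => x i) (stdN d) (gaussianReal 0 1) := by
  have h := measurePreserving_eval_multivariateGaussian (μ := (0 : Euc d))
    (Matrix.PosSemidef.one (n := Fin d) (R := ℝ)) (i := i)
  rw [multivariateGaussian_zero_one] at h
  simpa using h

lemma integrable_coord_pow_four (i : Fin d) :
    Integrable (fun x : Euc d => x i ^ 4) (stdN d) := by
  have h : Integrable (fun x : ℝ => x ^ 4) (gaussianReal 0 1) := by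
    have := (memLp_id_gaussianReal (μ := 0) (v := 1) 4).integrable_norm_pow (by norm_num)
    refine this.congr (ae_of_all _ fun x => ?_)
    simp only [id_eq, Real.norm_eq_abs]
    exact Even.pow_abs (by decide) x
  exact (measurePreserving_coord_stdN i).integrable_comp_of_integrable h

lemma integral_coord_pow_four (i : Fin d) :
    ∫ x : Euc d, x i ^ 4 ∂(stdN d) = gaussFourthMoment := by
  have hm := measurePreserving_coord_stdN i
  rw [gaussFourthMoment, ← hm.map_eq, integral_map hm.measurable.aemeasurable (by fun_prop)]

/-- Bounding the product by fourth powers treats `i = j` and `i ≠ j` alike, without using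
independence of coordinates. -/
lemma memLp_two_coord_mul_coord (i j : Fin d) :
    MemLp (fun x : Euc d => x i * x j) 2 (stdN d) ∧
      ∫ x : Euc d, (x i * x j) ^ 2 ∂(stdN d) ≤ gaussFourthMoment := by
  have hi := integrable_coord_pow_four i
  have hj := integrable_coord_pow_four j
  have hle : ∀ x : Euc d, (x i * x j) ^ 2 ≤ (x i ^ 4 + x j ^ 4) / 2 := fun x => by
    nlinarith [sq_nonneg (x i ^ 2 - x j ^ 2)]
  have hint : Integrable (fun x : Euc d => (x i ^ 4 + x j ^ 4) / 2) (stdN d) :=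
    (hi.add hj).div_const 2
  have hsq : Integrable (fun x : Euc d => (x i * x j) ^ 2) (stdN d) := by
    refine hint.mono' (by fun_prop) (ae_of_all _ fun x => ?_)
    rw [Real.norm_of_nonneg (sq_nonneg _)]
    exact hle x
  refine ⟨(memLp_two_iff_integrable_sq (by fun_prop)).2 hsq, ?_⟩
  calc _ ≤ ∫ x : Euc d, (x i ^ 4 + x j ^ 4) / 2 ∂(stdN d) := integral_mono hsq hint hle
    _ = gaussFourthMoment := by
      rw [integral_div, integral_add hi hj, integral_coord_pow_four, integral_coord_pow_four]
      ring

variable {A : Set (Euc d)} {n : ℕ}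

/-- There are `d² + d` averages, each of variance `O(1 / (p n))`. This is where the growth condition
`n_g / d² → ∞` originates. -/
lemma integral_momentDev_le {p : ℝ} (hp : 0 < p) (hpA : p ≤ (stdN d).real A) (hn : n ≠ 0) :
    Integrable (fun y : Fin n → Euc d => momentDev A y)
        (Measure.pi fun _ => cond (stdN d) A) ∧
      ∫ y : Fin n → Euc d, momentDev A y ∂(Measure.pi fun _ => cond (stdN d) A)
        ≤ (gaussFourthMoment + 1) * (d : ℕ) ^ 2 / (p * n) := by
  have hA0 : stdN d A ≠ 0 := stdN_ne_zero_of_pos_le hp hpA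
  have := cond_isProbabilityMeasure hA0
  set Q := cond (stdN d) A with hQ
  have hn0 : (0 : ℝ) < n := by positivity
  have h2 : ∀ i j : Fin d, MemLp (fun x : Euc d => x i * x j) 2 Q := fun i j =>
    memLp_cond hA0 (memLp_two_coord_mul_coord i j).1
  have h1 : ∀ i : Fin d, MemLp (fun x : Euc d => x i) 2 Q := fun i => memLp_coord_cond hA0 i
  have hI2 : ∀ i j : Fin d, Integrable (fun y : Fin n → Euc d =>
      ((1 / (n : ℝ)) * (∑ k, y k i * y k j) - ∫ x, x i * x j ∂Q) ^ 2)
      (Measure.pi fun _ => Q) := fun i j =>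
    (memLp_average_sub_pi (h2 i j) (∫ x, x i * x j ∂Q)).integrable_sq
  have hI1 : ∀ i : Fin d, Integrable (fun y : Fin n → Euc d =>
      ((1 / (n : ℝ)) * (∑ k, y k i) - ∫ x, x i ∂Q) ^ 2)
      (Measure.pi fun _ => Q) := fun i =>
    (memLp_average_sub_pi (h1 i) (∫ x, x i ∂Q)).integrable_sq
  have hS2 : Integrable (fun y : Fin n → Euc d => ∑ i, ∑ j,
      ((1 / (n : ℝ)) * (∑ k, y k i * y k j) - ∫ x, x i * x j ∂Q) ^ 2)
      (Measure.pi fun _ => Q) :=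
    integrable_finsetSum _ fun i _ => integrable_finsetSum _ fun j _ => hI2 i j
  have hS1 : Integrable (fun y : Fin n → Euc d => ∑ i,
      ((1 / (n : ℝ)) * (∑ k, y k i) - ∫ x, x i ∂Q) ^ 2)
      (Measure.pi fun _ => Q) := integrable_finsetSum _ fun i _ => hI1 i
  refine ⟨hS2.add hS1, ?_⟩
  unfold momentDev
  rw [integral_add hS2 hS1,
    integral_finsetSum _ fun i _ => integrable_finsetSum _ fun j _ => hI2 i j,
    integral_finsetSum _ fun i _ => hI1 i]
  simp_rw [integral_finsetSum _ fun j _ => hI2 _ j]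
  have hC := gaussFourthMoment_nonneg
  have hb2 : ∀ i j : Fin d, ∫ y : Fin n → Euc d,
      ((1 / (n : ℝ)) * (∑ k, y k i * y k j) - ∫ x, x i * x j ∂Q) ^ 2 ∂(Measure.pi fun _ => Q)
      ≤ gaussFourthMoment / p / n := fun i j => by
    refine (integral_sq_average_sub_le hn (h2 i j)).trans ?_
    gcongr
    refine (integral_cond_le (memLp_two_coord_mul_coord i j).1.integrable_sq
      fun x => sq_nonneg _).trans ?_
    exact div_le_div₀ hC (memLp_two_coord_mul_coord i j).2 hp hpA
  have hb1 : ∀ i : Fin d, ∫ y : Fin n → Euc d,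
      ((1 / (n : ℝ)) * (∑ k, y k i) - ∫ x, x i ∂Q) ^ 2 ∂(Measure.pi fun _ => Q)
      ≤ 1 / p / n := fun i => by
    refine (integral_sq_average_sub_le hn (h1 i)).trans ?_
    gcongr
    refine (integral_cond_le (memLp_coord_stdGaussian i).integrable_sq
      fun x => sq_nonneg _).trans ?_
    have h11 : ∫ x : Euc d, x i ^ 2 ∂(stdN d) = 1 := by
      have := integral_coord_mul_coord_stdGaussian i i
      simp_rw [← sq] at this
      simpa using this
    exact div_le_div₀ zero_le_one h11.le hp hpA
  have hd : (1 : ℝ) ≤ (d : ℕ) := by exact_mod_cast d.pos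
  calc _ ≤ ∑ _ : Fin d, ∑ _ : Fin d, gaussFourthMoment / p / n + ∑ _ : Fin d, 1 / p / n :=
        add_le_add (Finset.sum_le_sum fun i _ => Finset.sum_le_sum fun j _ => hb2 i j)
          (Finset.sum_le_sum fun _ _ => hb1 _)
    _ = (gaussFourthMoment * (d : ℕ) ^ 2 + (d : ℕ)) / (p * n) := by
        simp
        field_simp
    _ ≤ _ := by
        gcongr
        nlinarith

lemma momentDev_nonneg (A : Set (Euc d)) (y : Fin n → Euc d) : 0 ≤ momentDev A y :=
  add_nonneg (Finset.sum_nonneg fun _ _ => Finset.sum_nonneg fun _ _ => sq_nonneg _)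
    (Finset.sum_nonneg fun _ _ => sq_nonneg _)

lemma measure_momentDev_gt_le {p δ : ℝ} (hp : 0 < p) (hpA : p ≤ (stdN d).real A) (hn : n ≠ 0)
    (hδ : 0 < δ) :
    (Measure.pi fun _ : Fin n => cond (stdN d) A) {y | δ < momentDev A y}
      ≤ ENNReal.ofReal ((gaussFourthMoment + 1) * (d : ℕ) ^ 2 / (p * n) / δ) := by
  have hA0 : stdN d A ≠ 0 := stdN_ne_zero_of_pos_le hp hpA
  have := cond_isProbabilityMeasure hA0
  obtain ⟨hi, hle⟩ := integral_momentDev_le (n := n) hp hpA hn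
  have hm := mul_meas_ge_le_integral_of_nonneg
    (ae_of_all _ fun y => momentDev_nonneg A y) hi δ
  refine (measure_mono (t := {y | δ ≤ momentDev A y})
    fun y (hy : δ < momentDev A y) => hy.le).trans ?_
  rw [← ofReal_measureReal]
  refine ENNReal.ofReal_le_ofReal ?_
  rw [le_div_iff₀ hδ, mul_comm]
  exact hm.trans hle

end Empirical

/-! ### Measurability of the two criteria as functions of the sample. -/

section Measurability

open scoped MatrixOrder

variable {d : ℕ+} {n m : ℕ}

/-- The likelihood ratio of the standard Gaussian to the law of `μ + L Z`, along `z ↦ μ + L z`. -/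
def pulledLR (μ : Euc d) (L : Euc d →L[ℝ] Euc d) (z : Euc d) : ℝ :=
  |L.det| * Real.exp (‖z‖ ^ 2 / 2 - ‖μ + L z‖ ^ 2 / 2)

/-- Pulling back to standard normal variables fixes the integration measure, so the parameters
appear only in the integrand, with an explicit version of the Radon–Nikodym derivative. -/
lemma integral_pi_map_affine (μ : Euc d) (L : Euc d →L[ℝ] Euc d)
    {Φ : (Fin n → ℝ) × (Fin n → Euc d) → ℝ} (hΦ : Measurable Φ) :
    ∫ y : Fin n → Euc d,
        Φ (fun i => likelihoodRatio (stdN d) ((stdN d).map fun z => μ + L z) (y i), y)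
        ∂(Measure.pi fun _ => (stdN d).map fun z => μ + L z)
      = ∫ z : Fin n → Euc d, Φ (fun i => pulledLR μ L (z i), fun i => μ + L (z i))
        ∂(Measure.pi fun _ => stdN d) := by
  have hm : Measurable (fun z : Euc d => μ + L z) := by fun_prop
  have : IsProbabilityMeasure ((stdN d).map fun z => μ + L z) :=
    Measure.isProbabilityMeasure_map hm.aemeasurable
  have hlm : Measurable (likelihoodRatio (stdN d) ((stdN d).map fun z => μ + L z)) :=
    (Measure.measurable_rnDeriv _ _).ennreal_toReal
  have hpi := Measure.pi_map_pi (μ := fun _ : Fin n => stdN d)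
    (f := fun _ z => μ + L z) (fun _ => hm.aemeasurable)
  have hpm : Measurable (fun (z : Fin n → Euc d) i => μ + L (z i)) :=
    measurable_pi_lambda _ fun i => hm.comp (measurable_pi_apply i)
  rw [← hpi, integral_map hpm.aemeasurable (by
    refine (hΦ.comp ?_).aestronglyMeasurable
    fun_prop)]
  refine integral_congr_ae ?_
  have hall : ∀ᵐ z ∂(Measure.pi fun _ : Fin n => stdN d), ∀ i : Fin n,
      likelihoodRatio (stdN d) ((stdN d).map fun z => μ + L z) (μ + L (z i))
        = pulledLR μ L (z i) := by
    rw [ae_all_iff]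
    intro i
    exact (Measure.quasiMeasurePreserving_eval (μ := fun _ : Fin n => stdN d) i).ae
      (rnDeriv_stdGaussian_comp_affine μ L)
  filter_upwards [hall] with z hz
  simp only [hz]

lemma continuous_empMean : Continuous (fun y : Fin m → Euc d => empMean y) := by
  unfold empMean; fun_prop

lemma continuous_empCov : Continuous (fun y : Fin m → Euc d => empCov y) := by
  refine continuous_matrix fun i j => ?_
  have := continuous_empMean (d := d) (m := m)
  simp only [empCov, Matrix.of_apply]
  fun_prop

open scoped Matrix.Norms.L2Operator in
lemma continuous_sqrt_empCov :
    Continuous (fun y : Fin m → Euc d => (CFC.sqrt (empCov y) : Matrix (Fin d) (Fin d) ℝ)) :=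
  CFC.continuousOn_sqrt.comp_continuous continuous_empCov
    fun y => (empCov_posSemidef y).nonneg

lemma continuous_sqrtCLM_empCov :
    Continuous (fun y : Fin m → Euc d => sqrtCLM (empCov y)) := by
  have h : Continuous (fun M : Matrix (Fin d) (Fin d) ℝ => Matrix.toEuclideanCLM (𝕜 := ℝ) M) :=
    LinearMap.continuous_of_finiteDimensional
      ({ toFun := Matrix.toEuclideanCLM (𝕜 := ℝ) (n := Fin d)
         map_add' := map_add _
         map_smul' := map_smul _ } : Matrix (Fin d) (Fin d) ℝ →ₗ[ℝ] (Euc d →L[ℝ] Euc d))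
  exact h.comp continuous_sqrt_empCov

lemma empGauss_eq_map (y : Fin m → Euc d) :
    empGauss y = (stdN d).map fun z => empMean y + sqrtCLM (empCov y) z := rfl

/-- After the pullback, the arguments of `Φ` are jointly continuous in the sample and the normal
variables, also where the covariance degenerates: the factor `|det|` vanishes there, matching the
singular case. Both criteria are instances of `Φ`. -/
lemma measurable_integral_pi_empGauss {Φ : (Fin n → ℝ) × (Fin n → Euc d) → ℝ}
    (hΦ : Measurable Φ) :
    Measurable (fun y : Fin m → Euc d => ∫ x : Fin n → Euc d,
      Φ (fun i => likelihoodRatio (stdN d) (empGauss y) (x i), x)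
        ∂(Measure.pi fun _ => empGauss y)) := by
  simp_rw [empGauss_eq_map, integral_pi_map_affine _ _ hΦ]
  refine (StronglyMeasurable.integral_prod_right
    (f := fun (y : Fin m → Euc d) (z : Fin n → Euc d) =>
      Φ (fun i => pulledLR (empMean y) (sqrtCLM (empCov y)) (z i),
        fun i => empMean y + sqrtCLM (empCov y) (z i))) ?_).measurable
  refine (hΦ.comp ?_).stronglyMeasurable
  have h1 : Continuous (fun q : (Fin m → Euc d) × (Fin n → Euc d) => empMean q.1) :=
    continuous_empMean.comp continuous_fst
  have h2 : Continuous (fun q : (Fin m → Euc d) × (Fin n → Euc d) => sqrtCLM (empCov q.1)) :=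
    continuous_sqrtCLM_empCov.comp continuous_fst
  have h3 : ∀ i, Continuous (fun q : (Fin m → Euc d) × (Fin n → Euc d) =>
      empMean q.1 + sqrtCLM (empCov q.1) (q.2 i)) := fun i =>
    h1.add (h2.clm_apply ((continuous_apply i).comp continuous_snd))
  have h4 : Continuous (fun q : (Fin m → Euc d) × (Fin n → Euc d) =>
      (sqrtCLM (empCov q.1)).det) := by
    simp only [sqrtCLM, det_toEuclideanCLM]
    exact (continuous_sqrt_empCov.comp continuous_fst).matrix_det
  have hcont : Continuous (fun q : (Fin m → Euc d) × (Fin n → Euc d) =>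
      ((fun i => pulledLR (empMean q.1) (sqrtCLM (empCov q.1)) (q.2 i) : Fin n → ℝ),
        (fun i => empMean q.1 + sqrtCLM (empCov q.1) (q.2 i) : Fin n → Euc d))) := by
    refine Continuous.prodMk (continuous_pi fun i => ?_) (continuous_pi h3)
    have h5 := h3 i
    unfold pulledLR
    fun_prop
  exact hcont.measurable

lemma measurable_weightRatio_empGauss :
    Measurable (fun y : Fin m → Euc d => weightRatio (stdN d) (empGauss y) n) := by
  refine measurable_integral_pi_empGauss (Φ := fun q => (⨆ i, q.1 i) / ∑ i, q.1 i) ?_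
  refine Measurable.div (Measurable.iSup fun i => ?_) (Finset.measurable_sum _ fun i _ => ?_) <;>
  fun_prop

lemma measurable_isError_empGauss {A : Set (Euc d)} (hA : MeasurableSet A) :
    Measurable (fun y : Fin m → Euc d => isError (stdN d) (empGauss y) A n) := by
  refine measurable_integral_pi_empGauss (Φ := fun q =>
    |(1 / (n : ℝ)) * (∑ i, q.1 i * A.indicator (fun _ => (1 : ℝ)) (q.2 i))
      / (stdN d).real A - 1|) ?_
  have : ∀ i : Fin n, Measurable (fun q : (Fin n → ℝ) × (Fin n → Euc d) =>
      A.indicator (fun _ => (1 : ℝ)) (q.2 i)) := fun i =>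
    (measurable_const.indicator hA).comp (by fun_prop)
  fun_prop

end Measurability

/-! ### Convergence in law and the two efficiency statements. -/

lemma tendstoZeroInLaw_of_measure_gt {Ω : ℕ+ → Type*} [∀ d, MeasurableSpace (Ω d)]
    {P : ∀ d, Measure (Ω d)} [∀ d, IsProbabilityMeasure (P d)] {X : ∀ d, Ω d → ℝ}
    (hX : ∀ d, AEMeasurable (X d) (P d)) (h0 : ∀ d ω, 0 ≤ X d ω)
    (h : ∀ ε : ℝ, 0 < ε → Tendsto (fun d => P d {ω | ε < X d ω}) atTop (𝓝 0)) :
    TendstoZeroInLaw P X := by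
  refine ⟨hX, by fun_prop, ?_⟩
  -- By the portmanteau theorem only open sets matter, and against a point mass at `0` only those
  -- containing a ball around `0`.
  refine tendsto_of_forall_isOpen_le_liminf' fun G hG => ?_
  change (Measure.dirac ()).map (fun _ => (0 : ℝ)) G ≤ liminf (fun d => (P d).map (X d) G) atTop
  rw [Measure.map_const, measure_univ, one_smul, Measure.dirac_apply' _ hG.measurableSet]
  by_cases hG0 : (0 : ℝ) ∈ G
  · obtain ⟨r, hr, hball⟩ := Metric.isOpen_iff.1 hG 0 hG0
    have hlim : Tendsto (fun d => 1 - P d {ω | r / 2 < X d ω}) atTop (𝓝 (1 - 0)) :=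
      ENNReal.Tendsto.sub tendsto_const_nhds (h _ (half_pos hr)) (Or.inl ENNReal.one_ne_top)
    rw [tsub_zero] at hlim
    simp only [Set.indicator_of_mem hG0, Pi.one_apply]
    rw [← hlim.liminf_eq]
    refine liminf_le_liminf (Eventually.of_forall fun d => ?_)
    rw [Measure.map_apply_of_aemeasurable (hX d) hG.measurableSet, tsub_le_iff_right,
      ← measure_univ (μ := P d)]
    refine (measure_mono fun ω _ => ?_).trans (measure_union_le _ _)
    by_cases hω : r / 2 < X d ω
    · exact Or.inr hω
    · refine Or.inl (hball ?_)
      rw [Metric.mem_ball, Real.dist_eq, sub_zero, abs_of_nonneg (h0 d ω)]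
      linarith
  · simp [Set.indicator_of_notMem hG0]

/-- The entropy bound is required only with probability tending to one: on that event both criteria
are eventually below any `ε`, uniformly in `ω`. The deterministic case has an empty exceptional
event. -/
lemma efficient_of_integral_logLR_le {Ω : ℕ+ → Type*} [∀ d, MeasurableSpace (Ω d)]
    {P : ∀ d, Measure (Ω d)} [∀ d, IsProbabilityMeasure (P d)] {A : ∀ d, Set (Euc d)}
    (hA : ∀ d, MeasurableSet (A d)) {p : ℝ} (hp : 0 < p) (hpA : ∀ d, p ≤ (stdN d).real (A d))
    {μ : ∀ d, Ω d → Euc d} {S : ∀ d, Ω d → Matrix (Fin d) (Fin d) ℝ} {K : ℝ}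
    (hw : ∀ n d, AEMeasurable
      (fun ω => weightRatio (stdN d) (multivariateGaussian (μ d ω) (S d ω)) n) (P d))
    (he : ∀ n d, AEMeasurable
      (fun ω => isError (stdN d) (multivariateGaussian (μ d ω) (S d ω)) (A d) n) (P d))
    (hK : Tendsto (fun d => P d {ω | ¬ ((S d ω).PosDef ∧
      ∫ x, logLR (μ d ω) (invSqrtCLM (S d ω)) x ∂(stdN d) ≤ K)}) atTop (𝓝 0)) :
    EfficientInHighDim P stdN A (fun d ω => multivariateGaussian (μ d ω) (S d ω)) := by
  intro n hn
  have hgood : ∀ ε : ℝ, 0 < ε → ∀ᶠ d in atTop, ∀ ω, ((S d ω).PosDef ∧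
      ∫ x, logLR (μ d ω) (invSqrtCLM (S d ω)) x ∂(stdN d) ≤ K) →
      weightRatio (stdN d) (multivariateGaussian (μ d ω) (S d ω)) (n d) ≤ ε ∧
      isError (stdN d) (multivariateGaussian (μ d ω) (S d ω)) (A d) (n d) ≤ ε := by
    intro ε hε
    obtain ⟨N, hN⟩ := exists_forall_weightRatio_isError_le K hp hε
    filter_upwards [hn.eventually_ge_atTop N] with d hd ω hω
    have h := hN d (μ d ω) _ _ (sqrtCLM_invSqrtCLM hω.1) (invSqrtCLM_sqrtCLM hω.1) hω.2 (n d) hd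
    exact ⟨h.1, h.2 (A d) (hA d) (hpA d)⟩
  constructor
  · refine tendstoZeroInLaw_of_measure_gt (fun d => hw _ d) (fun d ω => weightRatio_nonneg _ _ _)
      fun ε hε => ?_
    refine tendsto_of_tendsto_of_tendsto_of_le_of_le' tendsto_const_nhds hK
      (Eventually.of_forall fun d => zero_le) ?_
    filter_upwards [hgood ε hε] with d hd
    exact measure_mono fun ω hω hg => absurd (hd ω hg).1 (not_le.2 hω)
  · refine tendstoZeroInLaw_of_measure_gt (fun d => he _ d) (fun d ω => isError_nonneg _ _ _ _)
      fun ε hε => ?_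
    refine tendsto_of_tendsto_of_tendsto_of_le_of_le' tendsto_const_nhds hK
      (Eventually.of_forall fun d => zero_le) ?_
    filter_upwards [hgood ε hε] with d hd
    exact measure_mono fun ω hω hg => absurd (hd ω hg).2 (not_le.2 hω)

lemma detEfficient_gaussA {A : ∀ d, Set (Euc d)} (hA : ∀ d, MeasurableSet (A d)) {p : ℝ}
    (hp : 0 < p) (hpA : ∀ d, p ≤ (stdN d).real (A d)) :
    DetEfficientInHighDim stdN A (fun d => gaussA (A d)) := by
  obtain ⟨δ, K, hδ, h⟩ := exists_integral_logLR_le_of_near hp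
  refine efficient_of_integral_logLR_le (μ := fun d _ => condMean (A d))
    (S := fun d _ => condCov (A d)) (K := K) hA hp hpA (fun n d => aemeasurable_const)
    (fun n d => aemeasurable_const) ?_
  have hd : ∀ d, (condCov (A d)).PosDef ∧
      ∫ x, logLR (condMean (A d)) (invSqrtCLM (condCov (A d))) x ∂(stdN d) ≤ K := fun d =>
    h d (A d) (hpA d) _ _ (condCov_isHermitian _) (by simpa using hδ.le) (by simpa using hδ.le)
  simp [hd]

lemma efficient_empGauss {A : ∀ d, Set (Euc d)} (hA : ∀ d, MeasurableSet (A d)) {p : ℝ}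
    (hp : 0 < p) (hpA : ∀ d, p ≤ (stdN d).real (A d))
    {Ω : ℕ+ → Type*} [∀ d, MeasurableSpace (Ω d)]
    {P : ∀ d, Measure (Ω d)} [∀ d, IsProbabilityMeasure (P d)]
    {ng : ℕ+ → ℕ} {Y : ∀ d, Fin (ng d) → Ω d → Euc d}
    (hng : Tendsto (fun d : ℕ+ => (ng d : ℝ) / ((d : ℕ) : ℝ) ^ 2) atTop atTop)
    (hind : ∀ d, iIndepFun (Y d) (P d))
    (hlaw : ∀ d k, HasLaw (Y d k) (cond (stdN d) (A d)) (P d)) :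
    EfficientInHighDim P stdN A (fun d ω => empGauss (fun k => Y d k ω)) := by
  have hYm : ∀ d, AEMeasurable (fun ω k => Y d k ω) (P d) := fun d =>
    aemeasurable_pi_lambda _ fun k => (hlaw d k).aemeasurable
  have hYlaw : ∀ d, (P d).map (fun ω k => Y d k ω)
      = Measure.pi fun _ : Fin (ng d) => cond (stdN d) (A d) := fun d => by
    rw [(iIndepFun_iff_map_fun_eq_pi_map fun k => (hlaw d k).aemeasurable).1 (hind d)]
    congr 1
    ext1 k
    exact (hlaw d k).map_eq
  obtain ⟨δ, K, hδ, h⟩ := exists_integral_logLR_empCov_le hp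
  refine efficient_of_integral_logLR_le (μ := fun d ω => empMean (fun k => Y d k ω))
    (S := fun d ω => empCov (fun k => Y d k ω)) (K := K) hA hp hpA
    (fun n d => measurable_weightRatio_empGauss.comp_aemeasurable (hYm d))
    (fun n d => (measurable_isError_empGauss (hA d)).comp_aemeasurable (hYm d)) ?_
  have hlim : Tendsto (fun d : ℕ+ => ENNReal.ofReal
      ((gaussFourthMoment + 1) * (d : ℕ) ^ 2 / (p * ng d) / δ)) atTop (𝓝 0) := by
    rw [← ENNReal.ofReal_zero]
    refine (ENNReal.continuous_ofReal.tendsto 0).comp ?_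
    have h1 := hng.inv_tendsto_atTop.const_mul ((gaussFourthMoment + 1) / p / δ)
    rw [mul_zero] at h1
    refine h1.congr fun d => ?_
    simp only [Pi.inv_apply, inv_div]
    field_simp
  refine tendsto_of_tendsto_of_tendsto_of_le_of_le' tendsto_const_nhds hlim
    (Eventually.of_forall fun d => zero_le) ?_
  filter_upwards [hng.eventually_gt_atTop 0] with d hd
  -- The ratio `ng d / d²` is eventually positive, which excludes the empty sample.
  have hn : ng d ≠ 0 := by
    rintro h0
    simp [h0] at hd
  calc P d _ ≤ P d ((fun ω k => Y d k ω) ⁻¹' {y | δ < momentDev (A d) y}) := by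
        refine measure_mono fun ω hω => ?_
        by_contra hc
        exact hω (h d (A d) (hpA d) _ _ (not_lt.1 hc))
    _ ≤ (P d).map (fun ω k => Y d k ω) {y | δ < momentDev (A d) y} :=
        Measure.le_map_apply (hYm d) _
    _ ≤ _ := by
        rw [hYlaw d]
        exact measure_momentDev_gt_le hp (hpA d) hn hδ

end HighDimIS

end

theorem corollary1
    (A : ∀ d : ℕ+, Set (HighDimIS.Euc d)) (hA : ∀ d, MeasurableSet (A d))
    (hp : 0 < ⨅ d : ℕ+, (HighDimIS.stdN d).real (A d)) :
    HighDimIS.DetEfficientInHighDim HighDimIS.stdN A (fun d => HighDimIS.gaussA (A d)) ∧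
    ∀ (Ω : ℕ+ → Type*) [∀ d, MeasurableSpace (Ω d)]
      (P : ∀ d, Measure (Ω d)) [∀ d, IsProbabilityMeasure (P d)]
      (ng : ℕ+ → ℕ) (Y : ∀ d, Fin (ng d) → Ω d → HighDimIS.Euc d),
      Tendsto (fun d : ℕ+ => (ng d : ℝ) / ((d : ℕ) : ℝ) ^ 2) atTop atTop →
      (∀ d, iIndepFun (Y d) (P d)) →
      (∀ d k, HasLaw (Y d k) (cond (HighDimIS.stdN d) (A d)) (P d)) →
      HighDimIS.EfficientInHighDim P HighDimIS.stdN A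
        (fun d ω => HighDimIS.empGauss (fun k => Y d k ω)) := by
  have hpA : ∀ d, (⨅ d : ℕ+, (HighDimIS.stdN d).real (A d)) ≤ (HighDimIS.stdN d).real (A d) :=
    fun d => ciInf_le ⟨0, by rintro _ ⟨d, rfl⟩; exact measureReal_nonneg⟩ d
  exact ⟨HighDimIS.detEfficient_gaussA hA hp hpA, fun Ω _ P _ ng Y hng hind hlaw =>
    HighDimIS.efficient_empGauss hA hp hpA hng hind hlaw⟩
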